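/- **Theorem 3.1.** Let $n\ge 1$ and let $(M,\omega)$ be a closed symplectic manifold of dimension $2n$, that is, $M$ is a compact Hausdorff smooth $2n$-dimensional manifold without boundary (not necessarily connected) and $\omega$ is a smooth, closed, nondegenerate $2$-form on $M$. Let $\mu$ be a Borel probability measure on $M$. Then for each $\epsilon>0$ there exist a number $a>0$ and a finite set $Z\subset\mathbb R^{2n}$ such that the open cubes $\prod_{i=1}^{2n}(z_i-\tfrac a2,z_i+\tfrac a2)$, $z\in Z$, are pairwise disjoint, and a symplectic embedding $\iota\colon W\hookrightarrow M$ of their union $W$, such that $\mu\big(M\setminus\iota(W)\big)<\epsilon$. Here $\mathbb R^{2n}$ has coordinates $(x_1,y_1,\dots,x_n,y_n)$, $W$ carries the restriction of the standard symplectic form $\omega_{\mathrm{std}}=\sum_{j=1}^n dx_j\wedge dy_j$, and a symplectic embedding is a smooth embedding $\iota$ with $\iota^*\omega=\omega_{\mathrm{std}}|_W$. -/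

import Mathlib

open scoped Manifold ContDiff

/-- The coordinate space `ℝ²ⁿ`, with coordinates `(x₁, y₁, …, xₙ, yₙ)` numbered from `0`. -/
abbrev R2n (n : ℕ) : Type := EuclideanSpace ℝ (Fin (2 * n))

/-- The (not necessarily continuous) differential `2`-forms on a `2n`-dimensional manifold `M`. -/
abbrev TwoForm (n : ℕ) (M : Type*) [TopologicalSpace M] [ChartedSpace (R2n n) M] : Type _ :=
  ∀ p : M, TangentSpace (𝓡 (2 * n)) p [⋀^Fin 2]→L[ℝ] ℝ

/-- The pullback `f^*Ω` of a `2`-form along a (differentiable) map between `2n`-manifolds. -/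
noncomputable def TwoForm.pullback {n : ℕ}
    {M : Type*} [TopologicalSpace M] [ChartedSpace (R2n n) M]
    {N : Type*} [TopologicalSpace N] [ChartedSpace (R2n n) N]
    (f : M → N) (Ω : TwoForm n N) : TwoForm n M :=
  fun p => (Ω (f p)).compContinuousLinearMap (mfderiv (𝓡 (2 * n)) (𝓡 (2 * n)) f p)

/-- The coordinate expression of a `2`-form in a chart `e`, a `2`-form on `ℝ²ⁿ` which is
meaningful on `e.target`. -/
noncomputable def TwoForm.inChart {n : ℕ}
    {M : Type*} [TopologicalSpace M] [ChartedSpace (R2n n) M]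
    (Ω : TwoForm n M) (e : OpenPartialHomeomorph M (R2n n)) :
    R2n n → R2n n [⋀^Fin 2]→L[ℝ] ℝ :=
  TwoForm.pullback e.symm Ω

/-- A symplectic form: a smooth, closed, nondegenerate `2`-form. -/
structure IsSymplecticForm {n : ℕ}
    {M : Type*} [TopologicalSpace M] [ChartedSpace (R2n n) M] (Ω : TwoForm n M) : Prop where
  smooth : ∀ e ∈ atlas (R2n n) M, ContDiffOn ℝ ∞ (Ω.inChart e) e.target
  closed : ∀ e ∈ atlas (R2n n) M, ∀ y ∈ e.target, extDeriv (Ω.inChart e) y = 0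
  nondegenerate : ∀ (p : M) (v : TangentSpace (𝓡 (2 * n)) p), v ≠ 0 →
    ∃ w : TangentSpace (𝓡 (2 * n)) p, Ω p ![v, w] ≠ 0

/-- The standard symplectic bilinear form `∑ⱼ dxⱼ ∧ dyⱼ` on the vector space `ℝ²ⁿ`. -/
noncomputable def stdAlternating (n : ℕ) : R2n n [⋀^Fin 2]→L[ℝ] ℝ where
  toFun v := ∑ j : Fin n,
    (v 0 ⟨2 * j, by omega⟩ * v 1 ⟨2 * j + 1, by omega⟩
      - v 0 ⟨2 * j + 1, by omega⟩ * v 1 ⟨2 * j, by omega⟩)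
  map_update_add' v i a b := by
    rw [← Finset.sum_add_distrib]
    refine Finset.sum_congr rfl fun j _ => ?_
    fin_cases i <;> simp <;> ring
  map_update_smul' v i c a := by
    rw [smul_eq_mul, Finset.mul_sum]
    refine Finset.sum_congr rfl fun j _ => ?_
    fin_cases i <;> simp <;> ring
  cont := by fun_prop
  map_eq_zero_of_eq' v i k hv hik := by
    have h : v 0 = v 1 := by
      fin_cases i <;> fin_cases k <;> simp_all
    refine Finset.sum_eq_zero fun j _ => ?_
    rw [h]
    ring

/-- The standard symplectic form `ω_std = ∑ⱼ dxⱼ ∧ dyⱼ` on the manifold `ℝ²ⁿ`. -/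
noncomputable def stdForm (n : ℕ) : TwoForm n (R2n n) :=
  fun _ => stdAlternating n

/-- The restriction of a `2`-form on `N` to an open subset `U`. -/
noncomputable def TwoForm.restrict {n : ℕ}
    {N : Type*} [TopologicalSpace N] [ChartedSpace (R2n n) N]
    (Ω : TwoForm n N) (U : TopologicalSpace.Opens N) : TwoForm n U :=
  TwoForm.pullback (Subtype.val : U → N) Ω

/-- `ι : (U, η) → (M, Ω)` is a symplectic embedding of `2n`-dimensional manifolds: a smooth
embedding with `ι^*Ω = η`. -/
structure IsSymplecticEmbedding {n : ℕ}
    {U : Type*} [TopologicalSpace U] [ChartedSpace (R2n n) U]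
    {M : Type*} [TopologicalSpace M] [ChartedSpace (R2n n) M]
    (η : TwoForm n U) (Ω : TwoForm n M) (ι : U → M) : Prop where
  isSmoothEmbedding : Manifold.IsSmoothEmbedding (𝓡 (2 * n)) (𝓡 (2 * n)) ∞ ι
  pullback_eq : TwoForm.pullback ι Ω = η

/-- The open cube in `ℝ²ⁿ` with centre `z` and side length `a`,
i.e. `∏ᵢ (zᵢ - a/2, zᵢ + a/2)`. -/
def openCube {n : ℕ} (z : R2n n) (a : ℝ) : Set (R2n n) :=
  {x | ∀ i, |x i - z i| < a / 2}

theorem isOpen_openCube {n : ℕ} (z : R2n n) (a : ℝ) : IsOpen (openCube z a) := by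
  simp only [openCube, Set.ofPred_forall]
  exact isOpen_iInter_of_finite fun i => isOpen_lt (by fun_prop) continuous_const

/-- The union of the open cubes of side length `a` centred at the points of `Z`,
as an open subset of `ℝ²ⁿ`. -/
def cubeUnion {n : ℕ} (Z : Finset (R2n n)) (a : ℝ) : TopologicalSpace.Opens (R2n n) where
  carrier := ⋃ z ∈ Z, openCube z a
  is_open' := isOpen_biUnion fun z _ => isOpen_openCube z a

-- Only finitely many symplectic charts are needed to cover `M`, and a measure can be cut up at
-- arbitrarily small cost. By Darboux, every point has a chart in which the form is standard. If two
-- such charts carry compact sets `K` and `K'`, inner regularity replaces `K' \ K` by a compact `L`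
-- inside it with small loss. Now `K` and `L` have disjoint neighbourhoods, and a translation, which
-- is symplectic, makes the two bounded images disjoint. The two restricted charts thus form one
-- disconnected Darboux chart. Induction along a finite cover gives a single chart `e` and a compact
-- `K` in its domain with small complement (`exists_isDarbouxChart_measure_compl_lt`).
--
-- It remains to fill `e '' K` by cubes. In each coordinate direction a finite measure charges only
-- countably many parallel hyperplanes, so a grid of any mesh can be shifted until its walls are
-- null for the image of `μ` restricted to `K`. If the mesh is fine enough, the open cells meeting
-- `e '' K` are finitely many, lie in `e.target` and cover `e '' K` up to a null set
-- (`exists_disjoint_cubes`). The embedding is `e.symm`. Atoms of `μ` do no harm.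
--
-- Darboux's theorem is obtained by Moser's method. Let `A` be the value of the form at the origin
-- and `β` the difference from `A`. Then `β = dα` with `α` vanishing to second order, and the
-- time-one flow of the field `X` with `ι_X (A + t β) = -α` pulls the form back to `A`; a symplectic
-- basis makes `A` standard. As `X` also vanishes to second order at the origin, the flow comes from
-- the inverse function theorem on `C(I, E)`: the map `g ↦ g - ∫ X(s, g s) ds` has derivative the
-- identity at `0`.

universe u

/-! ### Superposition operators on spaces of continuous maps -/

section Superposition

open Filter Topology

variable {K : Type*} [TopologicalSpace K] [CompactSpace K]
  {E F : Type u} [NormedAddCommGroup E] [NormedSpace ℝ E]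
  [NormedAddCommGroup F] [NormedSpace ℝ F]

/-- Pointwise evaluation of continuous families of continuous linear maps, as a continuous
bilinear map. -/
noncomputable def ContinuousMap.pointwiseApply (K : Type*) [TopologicalSpace K] [CompactSpace K]
    (E F : Type*) [NormedAddCommGroup E] [NormedSpace ℝ E]
    [NormedAddCommGroup F] [NormedSpace ℝ F] :
    C(K, E →L[ℝ] F) →L[ℝ] C(K, E) →L[ℝ] C(K, F) :=
  LinearMap.mkContinuous₂
    (LinearMap.mk₂ ℝ (fun (L : C(K, E →L[ℝ] F)) (h : C(K, E)) => (⟨fun s => L s (h s), by fun_prop⟩ : C(K, F)))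
      (fun _ _ _ => by ext; simp) (fun _ _ _ => by ext; simp)
      (fun _ _ _ => by ext; simp) (fun _ _ _ => by ext; simp)) 1
    (fun L h => by
      rw [ContinuousMap.norm_le _ (by positivity), one_mul]
      intro s
      exact (L s).le_of_opNorm_le_of_le (L.norm_coe_le_norm s) (h.norm_coe_le_norm s))

@[simp]
theorem ContinuousMap.pointwiseApply_apply (L : C(K, E →L[ℝ] F)) (h : C(K, E)) (s : K) :
    ContinuousMap.pointwiseApply K E F L h s = L s (h s) := rfl

/-- The mean value inequality is applied on each segment from `g s` to `g s + h s`. Continuity of `g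
↦ f' ∘ g` in the sup norm makes the bound uniform in `s`. -/
theorem ContinuousMap.hasFDerivAt_comp (f : C(E, F)) (f' : C(E, E →L[ℝ] F))
    (hf : ∀ x, HasFDerivAt f (f' x) x) (g : C(K, E)) :
    HasFDerivAt (fun g : C(K, E) => f.comp g)
      (ContinuousMap.pointwiseApply K E F (f'.comp g)) g := by
  rw [hasFDerivAt_iff_isLittleO_nhds_zero, Asymptotics.isLittleO_iff]
  intro c hc
  have hcont : ContinuousAt (fun g : C(K, E) => f'.comp g) g :=
    (ContinuousMap.continuous_postcomp f').continuousAt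
  obtain ⟨δ, hδ, hball⟩ := (Metric.continuousAt_iff (α := C(K, E)) (β := C(K, E →L[ℝ] F))).1 hcont c hc
  filter_upwards [Metric.ball_mem_nhds (0 : C(K, E)) hδ] with h hh
  rw [ContinuousMap.norm_le _ (by positivity)]
  intro s
  have key : ∀ y ∈ segment ℝ (g s) (g s + h s), ‖f' y - f' (g s)‖ ≤ c := by
    intro y hy
    rw [segment_eq_image'] at hy
    obtain ⟨t, ht, rfl⟩ := hy
    have h1 : dist (g + t • h) g < δ := by
      rw [dist_eq_norm, add_sub_cancel_left, norm_smul, Real.norm_of_nonneg ht.1]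
      rw [mem_ball_zero_iff] at hh
      nlinarith [norm_nonneg h, ht.1, ht.2]
    have h2 := (ContinuousMap.dist_apply_le_dist s).trans (hball h1).le
    rw [dist_eq_norm] at h2
    simpa using h2
  have := Convex.norm_image_sub_le_of_norm_hasFDerivWithin_le' (f := f) (f' := f')
    (φ := f' (g s)) (fun y _ => (hf y).hasFDerivWithinAt) key (convex_segment _ _)
    (left_mem_segment ℝ _ _) (right_mem_segment ℝ _ _)
  simp only [add_sub_cancel_left] at this
  refine le_trans ?_ (this.trans
    (mul_le_mul_of_nonneg_left (h.norm_coe_le_norm s) hc.le))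
  simp

/-- The derivative is again a superposition operator, by `f'`, followed by a continuous linear map.
The induction therefore replaces `F` by `E →L[ℝ] F`, which is why `E` and `F` share a universe. -/
theorem ContinuousMap.contDiff_nat_comp (n : ℕ) {F : Type u} [NormedAddCommGroup F]
    [NormedSpace ℝ F] (f : C(E, F)) (hf : ContDiff ℝ n f) :
    ContDiff ℝ n (fun g : C(K, E) => f.comp g) := by
  induction n generalizing F with
  | zero =>
    exact contDiff_zero.2 (ContinuousMap.continuous_postcomp f)
  | succ n ih =>
    have hf' := hf
    rw [Nat.cast_add, Nat.cast_one, contDiff_succ_iff_hasFDerivAt] at hf' ⊢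
    obtain ⟨f', hf'c, hf'd⟩ := hf'
    refine ⟨fun g => ContinuousMap.pointwiseApply K E F
      ((⟨f', hf'c.continuous⟩ : C(E, E →L[ℝ] F)).comp g), ?_, fun g => ?_⟩
    · exact (ContinuousMap.pointwiseApply K E F).contDiff.comp
        (ih ⟨f', hf'c.continuous⟩ hf'c)
    · exact ContinuousMap.hasFDerivAt_comp f ⟨f', hf'c.continuous⟩ hf'd g

theorem ContinuousMap.contDiff_comp (f : C(E, F)) (hf : ContDiff ℝ ∞ f) :
    ContDiff ℝ ∞ (fun g : C(K, E) => f.comp g) :=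
  contDiff_infty.2 fun n => ContinuousMap.contDiff_nat_comp n f (contDiff_infty.1 hf n)

end Superposition

/-! ### The Volterra operator -/

section Volterra

open Filter Topology

open unitInterval

variable {E : Type*} [NormedAddCommGroup E]

/-- The extension of a curve on `[0, 1]` to the real line by constants. -/
noncomputable def extendCurve (g : C(I, E)) : ℝ → E := fun t => g (Set.projIcc 0 1 zero_le_one t)

theorem continuous_extendCurve (g : C(I, E)) : Continuous (extendCurve g) :=
  g.continuous.comp continuous_projIcc

theorem extendCurve_coe (g : C(I, E)) (t : I) : extendCurve g t = g t := by
  simp [extendCurve]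

theorem norm_extendCurve_le (g : C(I, E)) (t : ℝ) : ‖extendCurve g t‖ ≤ ‖g‖ :=
  g.norm_coe_le_norm _

variable [NormedSpace ℝ E]

theorem norm_integral_extendCurve_le (g : C(I, E)) (t : I) :
    ‖∫ s in (0 : ℝ)..t, extendCurve g s‖ ≤ ‖g‖ := by
  have := intervalIntegral.norm_integral_le_of_norm_le_const (a := 0) (b := (t : ℝ)) (C := ‖g‖)
    (f := extendCurve g) (fun s _ => norm_extendCurve_le g s)
  refine this.trans (mul_le_of_le_one_right (norm_nonneg _) ?_)
  rw [sub_zero, abs_of_nonneg t.2.1]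
  exact t.2.2

/-- The operator sending a curve `g` on `[0, 1]` to `t ↦ ∫₀ᵗ g`. -/
noncomputable def volterra (E : Type*) [NormedAddCommGroup E] [NormedSpace ℝ E] [CompleteSpace E] :
    C(I, E) →L[ℝ] C(I, E) :=
  LinearMap.mkContinuous
    { toFun := fun g => ⟨fun t => ∫ s in (0 : ℝ)..t, extendCurve g s, by
        exact (intervalIntegral.continuous_primitive
          (fun a b => (continuous_extendCurve g).intervalIntegrable a b) 0).comp
          continuous_subtype_val⟩
      map_add' := fun f g => by
        ext t
        exact intervalIntegral.integral_add ((continuous_extendCurve f).intervalIntegrable _ _)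
          ((continuous_extendCurve g).intervalIntegrable _ _)
      map_smul' := fun c f => by
        ext t
        exact intervalIntegral.integral_smul c (extendCurve f) }
    1
    (fun g => by
      rw [ContinuousMap.norm_le _ (by positivity), one_mul]
      exact norm_integral_extendCurve_le g)

variable [CompleteSpace E]

theorem volterra_apply (g : C(I, E)) (t : I) :
    volterra E g t = ∫ s in (0 : ℝ)..t, extendCurve g s := rfl

theorem hasDerivAt_integral_extendCurve (g : C(I, E)) (t : ℝ) :
    HasDerivAt (fun t : ℝ => ∫ s in (0 : ℝ)..t, extendCurve g s) (extendCurve g t) t :=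
  intervalIntegral.integral_hasDerivAt_right
    ((continuous_extendCurve g).intervalIntegrable _ _)
    ((continuous_extendCurve g).stronglyMeasurableAtFilter _ _)
    (continuous_extendCurve g).continuousAt

end Volterra

/-! ### Smooth dependence of integral curves on the initial point, near an equilibrium -/

section Flow

open Filter Topology

open unitInterval

variable {E : Type u} [NormedAddCommGroup E] [NormedSpace ℝ E] [CompleteSpace E]

/-- The curve `s ↦ (s, g s)`. -/
noncomputable def graphCurve (g : C(I, E)) : C(I, ℝ × E) :=
  ContinuousLinearMap.compLeftContinuous ℝ I (ContinuousLinearMap.inr ℝ ℝ E) g +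
    ⟨fun s => ((s : ℝ), (0 : E)), by fun_prop⟩

omit [CompleteSpace E] in
@[simp]
theorem graphCurve_apply (g : C(I, E)) (s : I) : graphCurve g s = ((s : ℝ), g s) := by
  simp [graphCurve]

omit [CompleteSpace E] in
theorem hasFDerivAt_graphCurve (g : C(I, E)) :
    HasFDerivAt graphCurve
      (ContinuousLinearMap.compLeftContinuous ℝ I (ContinuousLinearMap.inr ℝ ℝ E)) g :=
  (ContinuousLinearMap.hasFDerivAt _).add_const _

omit [CompleteSpace E] in
theorem contDiff_graphCurve : ContDiff ℝ ∞ (graphCurve (E := E)) :=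
  (ContinuousLinearMap.contDiff _).add contDiff_const

/-- The defect of a curve as a solution of the integral equation of the vector field `X`. -/
noncomputable def integralDefect (X : C(ℝ × E, E)) (g : C(I, E)) : C(I, E) :=
  g - volterra E (X.comp (graphCurve g))

theorem contDiff_integralDefect (X : C(ℝ × E, E)) (hX : ContDiff ℝ ∞ X) :
    ContDiff ℝ ∞ (integralDefect X) :=
  contDiff_id.sub ((volterra E).contDiff.comp
    ((ContinuousMap.contDiff_comp X hX).comp contDiff_graphCurve))

theorem hasFDerivAt_integralDefect (X : C(ℝ × E, E)) (X' : C(ℝ × E, ℝ × E →L[ℝ] E))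
    (hX : ∀ p, HasFDerivAt X (X' p) p) (g : C(I, E)) :
    HasFDerivAt (integralDefect X)
      (ContinuousLinearMap.id ℝ _ - (volterra E).comp
        ((ContinuousMap.pointwiseApply I (ℝ × E) E (X'.comp (graphCurve g))).comp
          (ContinuousLinearMap.compLeftContinuous ℝ I (ContinuousLinearMap.inr ℝ ℝ E)))) g :=
  (hasFDerivAt_id g).sub ((volterra E).hasFDerivAt.comp g
    (HasFDerivAt.comp (g := fun f : C(I, ℝ × E) => X.comp f) g
      (ContinuousMap.hasFDerivAt_comp X X' hX _) (hasFDerivAt_graphCurve g)))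

/-- Near an equilibrium with vanishing linearization, a smooth time dependent vector field has
integral curves on `[0, 1]` which depend smoothly on the initial point, and whose derivatives
solve the linearized equation. -/
theorem exists_smooth_flow (X : ℝ × E → E) (hX : ContDiff ℝ ∞ X) (hX0 : ∀ t, X (t, 0) = 0)
    (hX1 : ∀ t v, fderiv ℝ X (t, 0) (0, v) = 0) :
    ∃ γ : E → C(I, E), γ 0 = 0 ∧ ∀ᶠ x in 𝓝 (0 : E), ContDiffAt ℝ ∞ γ x ∧
      ∃ c : ℝ → E, c 0 = x ∧ (∀ t : I, c t = γ x t) ∧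
        (∀ t ∈ Set.Icc (0 : ℝ) 1, HasDerivAt c (X (t, c t)) t) ∧
        ∀ v, ∃ η : ℝ → E, η 0 = v ∧ (∀ t : I, η t = fderiv ℝ γ x v t) ∧
          ∀ t ∈ Set.Icc (0 : ℝ) 1, HasDerivAt η (fderiv ℝ X (t, c t) (0, η t)) t := by
  set XC : C(ℝ × E, E) := ⟨X, hX.continuous⟩ with hXC
  have hX'c : Continuous (fderiv ℝ X) := hX.continuous_fderiv (by simp)
  set X' : C(ℝ × E, ℝ × E →L[ℝ] E) := ⟨fderiv ℝ X, hX'c⟩ with hX'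
  have hXd : ∀ p, HasFDerivAt XC (X' p) p := fun p =>
    (hX.differentiable (by simp) p).hasFDerivAt
  set G := integralDefect XC with hG
  have hGs : ContDiff ℝ ∞ G := contDiff_integralDefect XC hX
  have hGd := hasFDerivAt_integralDefect XC X' hXd
  rw [← hG] at hGd
  have hG0 : G 0 = 0 := by
    have : XC.comp (graphCurve 0) = 0 := by
      ext s
      simp [hXC, hX0]
    rw [hG, integralDefect, this, map_zero, sub_zero]
  -- The spatial linearization of `X` vanishes along the zero curve, so the Volterra term drops out.
  have hGd0 : HasFDerivAt G ((ContinuousLinearEquiv.refl ℝ C(I, E) :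
      C(I, E) ≃L[ℝ] C(I, E)) : C(I, E) →L[ℝ] C(I, E)) 0 := by
    convert hGd 0 using 1
    ext h s
    have : ContinuousMap.pointwiseApply I (ℝ × E) E (X'.comp (graphCurve 0))
        (ContinuousLinearMap.compLeftContinuous ℝ I (ContinuousLinearMap.inr ℝ ℝ E) h) = 0 := by
      ext r
      simp [hX', hX1]
    change h s = h s - volterra E (ContinuousMap.pointwiseApply I (ℝ × E) E
      (X'.comp (graphCurve 0)) (ContinuousLinearMap.compLeftContinuous ℝ I
        (ContinuousLinearMap.inr ℝ ℝ E) h)) s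
    rw [this]
    simp
  set e := hGs.contDiffAt.toOpenPartialHomeomorph G hGd0 (by simp) with he
  have heG : ∀ g, e g = G g := fun g => rfl
  have h0s : (0 : C(I, E)) ∈ e.source :=
    hGs.contDiffAt.mem_toOpenPartialHomeomorph_source hGd0 (by simp)
  have h0t : (0 : C(I, E)) ∈ e.target := by
    have := e.map_source h0s
    rwa [heG, hG0] at this
  have hsymm0 : e.symm 0 = 0 := by
    have := e.left_inv h0s
    rwa [heG, hG0] at this
  -- The integral equation with initial point `x` reads `G g = k x`, where `k x` is the constant
  -- curve.
  set k : E →L[ℝ] C(I, E) := ContinuousLinearMap.const ℝ I with hk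
  refine ⟨fun x => e.symm (k x), by simp [hsymm0], ?_⟩
  -- Invertibility is an open condition, so the local inverse is smooth at all points near `0`, not
  -- only at `0`.
  have hinv : ∀ᶠ g in 𝓝 (0 : C(I, E)), fderiv ℝ G g ∈
      Set.range ((↑) : (C(I, E) ≃L[ℝ] C(I, E)) → C(I, E) →L[ℝ] C(I, E)) := by
    refine (hGs.continuous_fderiv (by simp)).continuousAt.eventually ?_
    rw [hGd0.fderiv]
    exact ContinuousLinearEquiv.nhds _
  have hk0 : Tendsto k (𝓝 0) (𝓝 0) := by
    have := k.continuous.tendsto 0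
    rwa [map_zero] at this
  have hes : Tendsto (fun x => e.symm (k x)) (𝓝 0) (𝓝 0) := by
    have := (e.continuousAt_symm h0t).tendsto
    rw [hsymm0] at this
    exact this.comp hk0
  have htgt : ∀ᶠ x in 𝓝 (0 : E), k x ∈ e.target := hk0.eventually (e.open_target.mem_nhds h0t)
  filter_upwards [hes.eventually hinv, htgt, htgt.eventually_nhds] with x hx hxt hxtn
  obtain ⟨f', hf'⟩ := hx
  set γ : E → C(I, E) := fun x => e.symm (k x) with hγ
  have hsm : ContDiffAt ℝ ∞ γ x := by
    have : ContDiffAt ℝ ∞ e.symm (k x) := by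
      refine e.contDiffAt_symm (f₀' := f') hxt ?_ hGs.contDiffAt
      rw [hf']
      exact (hGs.differentiable (by simp) _).hasFDerivAt
    exact this.comp x k.contDiff.contDiffAt
  have hGγ : ∀ᶠ y in 𝓝 x, G (γ y) = k y := by
    filter_upwards [hxtn] with y hy
    rw [hγ, ← heG, e.right_inv hy]
  refine ⟨hsm, ?_⟩
  have hγx : γ x = k x + volterra E (XC.comp (graphCurve (γ x))) := by
    have := hGγ.self_of_nhds
    rw [hG, integralDefect, sub_eq_iff_eq_add] at this
    exact this
  set w := XC.comp (graphCurve (γ x)) with hw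
  have hcγ : ∀ t : I, x + ∫ s in (0 : ℝ)..t, extendCurve w s = γ x t := fun t => by
    conv_rhs => rw [hγx]
    rfl
  -- Extending the integrand to the real line gives two-sided derivatives at the endpoints `0` and
  -- `1` too.
  refine ⟨fun t => x + ∫ s in (0 : ℝ)..t, extendCurve w s, by simp, hcγ, ?_, ?_⟩
  · intro t ht
    have h := (hasDerivAt_integral_extendCurve w t).const_add x
    convert h using 1
    have := extendCurve_coe w ⟨t, ht⟩
    simp only [] at this
    rw [this, hw]
    simp only [ContinuousMap.comp_apply, graphCurve_apply]
    rw [hcγ ⟨t, ht⟩]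
    rfl
  · intro v
    set h := fderiv ℝ γ x v with hh
    have hγd : HasFDerivAt γ (fderiv ℝ γ x) x := (hsm.differentiableAt (by simp)).hasFDerivAt
    -- Differentiating `G (γ y) = k y` in `y` yields the integrated linearized equation.
    have hd := ((hGd (γ x)).comp x hγd).unique
      (k.hasFDerivAt.congr_of_eventuallyEq (hGγ.mono fun y hy => hy))
    have hdv := congrArg (fun L => L v) hd
    set u := ContinuousMap.pointwiseApply I (ℝ × E) E (X'.comp (graphCurve (γ x)))
          (ContinuousLinearMap.compLeftContinuous ℝ I (ContinuousLinearMap.inr ℝ ℝ E) h) with hu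
    have hdv' : h = k v + volterra E u := by
      rw [← sub_eq_iff_eq_add]
      exact hdv
    have hηh : ∀ t : I, v + ∫ s in (0 : ℝ)..t, extendCurve u s = h t := fun t => by
      conv_rhs => rw [hdv']
      rfl
    refine ⟨fun t => v + ∫ s in (0 : ℝ)..t, extendCurve u s, by simp, hηh, ?_⟩
    intro t ht
    have h1 := (hasDerivAt_integral_extendCurve u t).const_add v
    convert h1 using 1
    have := extendCurve_coe u ⟨t, ht⟩
    simp only [] at this
    have hct : x + ∫ s in (0 : ℝ)..t, extendCurve w s = γ x ⟨t, ht⟩ := hcγ ⟨t, ht⟩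
    have hηt : v + ∫ s in (0 : ℝ)..t, extendCurve u s = h ⟨t, ht⟩ := hηh ⟨t, ht⟩
    beta_reduce
    rw [this, hct, hηt]
    simp [hu, hX']

end Flow

/-! ### The Poincaré lemma for closed `2`-forms on a ball -/

section Poincare

set_option maxSynthPendingDepth 3

open Filter Topology

open unitInterval

variable {E F : Type u} [NormedAddCommGroup E] [NormedSpace ℝ E]
  [NormedAddCommGroup F] [NormedSpace ℝ F] [CompleteSpace F]

/-- Writing a parameter integral through the Volterra and superposition operators reduces
differentiation under the integral sign to the chain rule. -/
theorem volterra_one_comp_graphCurve_const (f : C(ℝ × E, F)) (x : E) :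
    volterra F (f.comp (graphCurve (ContinuousLinearMap.const ℝ I x))) 1 =
      ∫ t in (0 : ℝ)..1, f (t, x) := by
  rw [volterra_apply]
  refine intervalIntegral.integral_congr fun t ht => ?_
  rw [Set.Icc.coe_one, Set.uIcc_of_le zero_le_one] at ht
  exact (extendCurve_coe (f.comp (graphCurve (ContinuousLinearMap.const ℝ I x))) ⟨t, ht⟩).trans
    (by simp)

theorem contDiff_integral_param (f : ℝ × E → F) (hf : ContDiff ℝ ∞ f) :
    ContDiff ℝ ∞ (fun x => ∫ t in (0 : ℝ)..1, f (t, x)) := by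
  have : (fun x => ∫ t in (0 : ℝ)..1, f (t, x)) = fun x =>
      ContinuousMap.evalCLM ℝ (1 : I) (volterra F ((⟨f, hf.continuous⟩ : C(ℝ × E, F)).comp
        (graphCurve (ContinuousLinearMap.const ℝ I x)))) :=
    funext fun x => (volterra_one_comp_graphCurve_const ⟨f, hf.continuous⟩ x).symm
  rw [this]
  exact (ContinuousMap.evalCLM ℝ (1 : I)).contDiff.comp ((volterra F).contDiff.comp
    ((ContinuousMap.contDiff_comp ⟨f, hf.continuous⟩ hf).comp
      (contDiff_graphCurve.comp (ContinuousLinearMap.const ℝ I : E →L[ℝ] C(I, E)).contDiff)))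

theorem fderiv_integral_param (f : ℝ × E → F) (hf : ContDiff ℝ ∞ f) (x v : E) :
    fderiv ℝ (fun x => ∫ t in (0 : ℝ)..1, f (t, x)) x v =
      ∫ t in (0 : ℝ)..1, fderiv ℝ f (t, x) (0, v) := by
  have hf'c : Continuous (fderiv ℝ f) := hf.continuous_fderiv (by simp)
  have h1 := ContinuousMap.hasFDerivAt_comp (K := I) ⟨f, hf.continuous⟩ ⟨fderiv ℝ f, hf'c⟩
    (fun p => (hf.differentiable (by simp) p).hasFDerivAt)
    (graphCurve (ContinuousLinearMap.const ℝ I x))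
  have h2 := HasFDerivAt.comp (g := fun g : C(I, ℝ × E) => (⟨f, hf.continuous⟩ : C(ℝ × E, F)).comp g)
    x h1 ((hasFDerivAt_graphCurve (ContinuousLinearMap.const ℝ I x)).comp x
      (ContinuousLinearMap.const ℝ I : E →L[ℝ] C(I, E)).hasFDerivAt)
  have h3 := (((ContinuousMap.evalCLM ℝ (1 : I)).hasFDerivAt).comp _
    (((volterra F).hasFDerivAt).comp x h2))
  have : (fun x => ∫ t in (0 : ℝ)..1, f (t, x)) = fun x =>
      ContinuousMap.evalCLM ℝ (1 : I) (volterra F ((⟨f, hf.continuous⟩ : C(ℝ × E, F)).comp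
        (graphCurve (ContinuousLinearMap.const ℝ I x)))) :=
    funext fun x => (volterra_one_comp_graphCurve_const ⟨f, hf.continuous⟩ x).symm
  rw [this]
  refine (congrArg (fun L => L v) h3.fderiv).trans ?_
  refine Eq.trans ?_ (volterra_one_comp_graphCurve_const
    (⟨fun p => fderiv ℝ f p (0, v), by fun_prop⟩ : C(ℝ × E, F)) x)
  change volterra F _ 1 = _
  congr 2

set_option maxHeartbeats 800000 in
/-- A smooth `2`-form which is closed on a ball has a primitive there. -/
theorem exists_primitive_of_closed [CompleteSpace E] (β : E → E →L[ℝ] E →L[ℝ] ℝ)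
    (hβ : ContDiff ℝ ∞ β) {r : ℝ}
    (hskew : ∀ y ∈ Metric.ball (0 : E) r, ∀ v w, β y v w = -β y w v)
    (hclosed : ∀ y ∈ Metric.ball (0 : E) r, ∀ u v w,
      fderiv ℝ β y u v w - fderiv ℝ β y v u w + fderiv ℝ β y w u v = 0) (hβ0 : β 0 = 0) :
    ∃ α : E → E →L[ℝ] ℝ, ContDiff ℝ ∞ α ∧ α 0 = 0 ∧ fderiv ℝ α 0 = 0 ∧
      ∀ y ∈ Metric.ball (0 : E) r, ∀ v w, fderiv ℝ α y v w - fderiv ℝ α y w v = β y v w := by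
  -- Radial homotopy formula: `α x w = ∫₀¹ t β(t x)(x, w) dt`. It vanishes to second order at `0`
  -- because `β 0 = 0`.
  set f : ℝ × E → E →L[ℝ] E →L[ℝ] ℝ := fun p => p.1 • β (p.1 • p.2) with hf
  have hfs : ContDiff ℝ ∞ f := contDiff_fst.smul (hβ.comp (contDiff_fst.smul contDiff_snd))
  set P : E → E →L[ℝ] E →L[ℝ] ℝ := fun x => ∫ t in (0 : ℝ)..1, f (t, x) with hP
  have hPs : ContDiff ℝ ∞ P := contDiff_integral_param f hfs
  have hPd : ∀ x, HasFDerivAt P (fderiv ℝ P x) x :=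
    fun x => (hPs.differentiable (by simp) x).hasFDerivAt
  have hP0 : P 0 = 0 := by simp [hP, hf, hβ0]
  have hαd : ∀ x, HasFDerivAt (fun x => P x x) _ x := fun x => (hPd x).clm_apply (hasFDerivAt_id x)
  have hαd' : ∀ x v w, fderiv ℝ (fun x => P x x) x v w = fderiv ℝ P x v x w + P x v w := by
    intro x v w
    rw [(hαd x).fderiv]
    simp [add_comm]
  have hfd : ∀ t x v, fderiv ℝ f (t, x) (0, v) = t ^ 2 • fderiv ℝ β (t • x) v := by
    intro t x v
    have hb : HasFDerivAt β (fderiv ℝ β (t • x)) (t • x) :=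
      (hβ.differentiable (by simp) _).hasFDerivAt
    have h1 : HasFDerivAt (fun y : E => f (t, y)) ((fderiv ℝ f (t, x)).comp
        (ContinuousLinearMap.inr ℝ ℝ E)) x :=
      HasFDerivAt.comp (g := f) x (hfs.differentiable (by simp) (t, x)).hasFDerivAt
        (hasFDerivAt_prodMk_right t x)
    have h2 : HasFDerivAt (fun y : E => f (t, y)) (t • (fderiv ℝ β (t • x)).comp
        (t • ContinuousLinearMap.id ℝ E)) x :=
      (HasFDerivAt.comp x hb ((hasFDerivAt_id x).const_smul t)).const_smul t
    have h3 := congrArg (fun L => L v) (h1.unique h2)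
    simpa [smul_smul, pow_two] using h3
  refine ⟨fun x => P x x, hPs.clm_apply contDiff_id, by simp [hP0], ?_, ?_⟩
  · ext v w
    rw [hαd']
    simp [hP0]
  · intro x hx v w
    have hcf : Continuous f := hfs.continuous
    have hcβ : Continuous β := hβ.continuous
    have hcβ' : Continuous (fderiv ℝ β) := hβ.continuous_fderiv (by simp)
    have hcf1 : Continuous fun t : ℝ => f (t, x) := by fun_prop
    have hPapp : ∀ a b, P x a b = ∫ t in (0 : ℝ)..1, t * β (t • x) a b := by
      intro a b
      have h1 := ContinuousLinearMap.intervalIntegral_apply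
        (hcf1.intervalIntegrable (μ := MeasureTheory.volume) 0 1) a
      have h2 := ContinuousLinearMap.intervalIntegral_apply
        ((hcf1.clm_apply continuous_const).intervalIntegrable
          (μ := MeasureTheory.volume) 0 1 : IntervalIntegrable (fun t => f (t, x) a) _ _ _) b
      rw [hP]
      beta_reduce
      rw [h1, h2]
      simp [hf]
    have hDPapp : ∀ c a b, fderiv ℝ P x c a b =
        ∫ t in (0 : ℝ)..1, t ^ 2 * fderiv ℝ β (t • x) c a b := by
      intro c a b
      have hc : Continuous fun t : ℝ => t ^ 2 • fderiv ℝ β (t • x) c := by fun_prop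
      have h1 := ContinuousLinearMap.intervalIntegral_apply
        (hc.intervalIntegrable (μ := MeasureTheory.volume) 0 1) a
      have h2 := ContinuousLinearMap.intervalIntegral_apply
        ((hc.clm_apply continuous_const).intervalIntegrable
          (μ := MeasureTheory.volume) 0 1 :
          IntervalIntegrable (fun t : ℝ => (t ^ 2 • fderiv ℝ β (t • x) c) a) _ _ _) b
      rw [hP, fderiv_integral_param f hfs]
      simp only [hfd]
      rw [h1, h2]
      simp
    rw [hαd', hαd', hPapp, hPapp, hDPapp, hDPapp]
    have hi1 : ∀ c a b, IntervalIntegrable (fun t : ℝ => t ^ 2 * fderiv ℝ β (t • x) c a b)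
        MeasureTheory.volume 0 1 := fun c a b =>
      Continuous.intervalIntegrable (by fun_prop) 0 1
    have hi2 : ∀ a b, IntervalIntegrable (fun t : ℝ => t * β (t • x) a b)
        MeasureTheory.volume 0 1 := fun a b =>
      Continuous.intervalIntegrable (by fun_prop) 0 1
    rw [← intervalIntegral.integral_add (hi1 _ _ _) (hi2 _ _),
      ← intervalIntegral.integral_add (hi1 _ _ _) (hi2 _ _),
      ← intervalIntegral.integral_sub ((hi1 _ _ _).add (hi2 _ _)) ((hi1 _ _ _).add (hi2 _ _))]
    -- By skewness and closedness the integrand of `dα` is this exact derivative in `t`.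
    have hderiv : ∀ t : ℝ, HasDerivAt (fun t : ℝ => t ^ 2 * β (t • x) v w)
        (2 * t * β (t • x) v w + t ^ 2 * fderiv ℝ β (t • x) x v w) t := by
      intro t
      have hb : HasFDerivAt β (fderiv ℝ β (t • x)) (t • x) :=
        (hβ.differentiable (by simp) _).hasFDerivAt
      have h1 : HasDerivAt (fun t : ℝ => t • x) x t := by
        simpa using (hasDerivAt_id t).smul_const x
      have h2 : HasDerivAt (fun t : ℝ => β (t • x) v w) (fderiv ℝ β (t • x) x v w) t :=
        (((ContinuousLinearMap.apply ℝ ℝ w).comp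
          (ContinuousLinearMap.apply ℝ (E →L[ℝ] ℝ) v)).hasFDerivAt.comp_hasDerivAt t
            (hb.comp_hasDerivAt t h1))
      simpa using (hasDerivAt_pow 2 t).fun_mul h2
    have hint : (∫ t in (0 : ℝ)..1, (2 * t * β (t • x) v w + t ^ 2 * fderiv ℝ β (t • x) x v w)) =
        β x v w := by
      rw [intervalIntegral.integral_eq_sub_of_hasDerivAt (fun t _ => hderiv t)
        (Continuous.intervalIntegrable (by fun_prop) 0 1)]
      simp
    rw [← hint]
    refine intervalIntegral.integral_congr fun t ht => ?_
    rw [Set.uIcc_of_le zero_le_one] at ht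
    have htx : t • x ∈ Metric.ball (0 : E) r := by
      rw [mem_ball_zero_iff] at hx ⊢
      rw [norm_smul, Real.norm_of_nonneg ht.1]
      nlinarith [norm_nonneg x, ht.1, ht.2]
    have e1 := hskew _ htx w v
    have e2 := hclosed _ htx x v w
    linear_combination (-t) * e1 - t ^ 2 * e2

end Poincare

/-! ### Moser's argument -/

section Moser

set_option maxSynthPendingDepth 3

open Filter Topology

open unitInterval

/-- A bump function cuts the germ off. The flow and the primitive are built from globally smooth
data, whereas the form and operator inversion are smooth only locally. -/
theorem exists_contDiff_eventuallyEq {V W : Type*} [NormedAddCommGroup V] [NormedSpace ℝ V]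
    [FiniteDimensional ℝ V] [NormedAddCommGroup W] [NormedSpace ℝ W] {f : V → W} {a : V}
    (h : ∀ᶠ y in 𝓝 a, ContDiffAt ℝ ∞ f y) : ∃ g : V → W, ContDiff ℝ ∞ g ∧ g =ᶠ[𝓝 a] f := by
  obtain ⟨ρ, hρ, hball⟩ := Metric.eventually_nhds_iff_ball.1 h
  let χ : ContDiffBump a := ⟨ρ / 4, ρ / 2, by positivity, by linarith⟩
  refine ⟨fun y => χ y • f y, contDiff_iff_contDiffAt.2 fun x => ?_, ?_⟩
  · by_cases hx : x ∈ Metric.ball a ρ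
    · exact χ.contDiff.contDiffAt.smul (hball x hx)
    · have : (fun y => χ y • f y) =ᶠ[𝓝 x] fun _ => 0 := by
        have hx' : x ∈ (Metric.closedBall a (ρ / 2))ᶜ := by
          simp only [Metric.mem_ball, not_lt, Set.mem_compl_iff, Metric.mem_closedBall,
            not_le] at hx ⊢
          linarith
        filter_upwards [Metric.isClosed_closedBall.isOpen_compl.mem_nhds hx'] with y hy
        simp only [Set.mem_compl_iff, Metric.mem_closedBall, not_le] at hy
        rw [χ.zero_of_le_dist hy.le, zero_smul]
      exact contDiffAt_const.congr_of_eventuallyEq this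
  · filter_upwards [χ.eventuallyEq_one] with y hy
    simp [hy]

variable {E : Type u} [NormedAddCommGroup E] [NormedSpace ℝ E]

/-- A bilinear form which is nondegenerate is an isomorphism onto the dual. -/
theorem exists_equiv_of_nondegenerate [FiniteDimensional ℝ E] (A : E →L[ℝ] E →L[ℝ] ℝ)
    (hA : ∀ v, v ≠ 0 → ∃ w, A v w ≠ 0) : ∃ e : E ≃L[ℝ] (E →L[ℝ] ℝ), (e : E →L[ℝ] E →L[ℝ] ℝ) = A := by
  have hinj : Function.Injective (A : E →ₗ[ℝ] E →L[ℝ] ℝ) := by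
    rw [← LinearMap.ker_eq_bot, LinearMap.ker_eq_bot']
    intro v hv
    by_contra hne
    obtain ⟨w, hw⟩ := hA v hne
    exact hw (by rw [show A v = 0 from hv]; rfl)
  have hdim : Module.finrank ℝ E = Module.finrank ℝ (E →L[ℝ] ℝ) := by
    rw [← (LinearMap.toContinuousLinearMap (𝕜 := ℝ) (E := E) (F' := ℝ)).finrank_eq]
    exact Subspace.dual_finrank_eq.symm
  refine ⟨(LinearEquiv.ofInjectiveOfFinrankEq (A : E →ₗ[ℝ] E →L[ℝ] ℝ) hinj
    hdim).toContinuousLinearEquiv, ?_⟩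
  ext v w
  rfl

/-- The value of a moving `2`-form on solutions of the linearized equation is constant: the
pointwise identity behind Moser's argument. -/
theorem hasDerivAt_moser {β : E → E →L[ℝ] E →L[ℝ] ℝ} {α : E → E →L[ℝ] ℝ} {A : E →L[ℝ] E →L[ℝ] ℝ}
    {X : ℝ × E → E} {t : ℝ} {c η ζ : ℝ → E}
    (hβ : DifferentiableAt ℝ β (c t)) (hα : DifferentiableAt ℝ α (c t))
    (hX : DifferentiableAt ℝ X (t, c t))
    (hA : ∀ v w, A v w = -A w v) (hskew : ∀ v w, β (c t) v w = -β (c t) w v)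
    (hclosed : ∀ u v w, fderiv ℝ β (c t) u v w - fderiv ℝ β (c t) v u w +
      fderiv ℝ β (c t) w u v = 0)
    (hprim : ∀ v w, fderiv ℝ α (c t) v w - fderiv ℝ α (c t) w v = β (c t) v w)
    (hXα : ∀ᶠ y in 𝓝 (c t), (A + t • β y) (X (t, y)) = -α y)
    (hc : HasDerivAt c (X (t, c t)) t) (hη : HasDerivAt η (fderiv ℝ X (t, c t) (0, η t)) t)
    (hζ : HasDerivAt ζ (fderiv ℝ X (t, c t) (0, ζ t)) t) :
    HasDerivAt (fun s => (A + s • β (c s)) (η s) (ζ s)) 0 t := by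
  -- This is the spatial derivative of `ι_X (A + t β) = -α` in the direction `v`.
  have hlin : ∀ v w, t * fderiv ℝ β (c t) v (X (t, c t)) w +
      (A + t • β (c t)) (fderiv ℝ X (t, c t) (0, v)) w = -fderiv ℝ α (c t) v w := by
    intro v w
    have h1 : HasFDerivAt (fun y : E => X (t, y)) ((fderiv ℝ X (t, c t)).comp
        (ContinuousLinearMap.inr ℝ ℝ E)) (c t) :=
      HasFDerivAt.comp (g := X) (c t) hX.hasFDerivAt (hasFDerivAt_prodMk_right t (c t))
    have h2 : HasFDerivAt (fun y => A + t • β y) (t • fderiv ℝ β (c t)) (c t) :=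
      (hβ.hasFDerivAt.const_smul t).const_add A
    have h3 := (h2.clm_apply h1).unique
      ((hα.hasFDerivAt.neg).congr_of_eventuallyEq hXα)
    have h4 := congrArg (fun L => L v w) h3
    simp only [add_apply, ContinuousLinearMap.comp_apply,
      ContinuousLinearMap.flip_apply, smul_apply, smul_eq_mul,
      neg_apply, ContinuousLinearMap.inr_apply] at h4 ⊢
    linear_combination h4
  have hb : HasDerivAt (fun s => β (c s)) (fderiv ℝ β (c t) (X (t, c t))) t :=
    hβ.hasFDerivAt.comp_hasDerivAt t hc
  have h5 : HasDerivAt (fun s => A + s • β (c s))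
      (t • fderiv ℝ β (c t) (X (t, c t)) + (1 : ℝ) • β (c t)) t :=
    ((hasDerivAt_id t).smul hb).const_add A
  have h6 := (h5.clm_apply hη).clm_apply hζ
  refine h6.congr_deriv ?_
  have e1 := hlin (η t) (ζ t)
  have e2 := hlin (ζ t) (η t)
  have e3 := hclosed (X (t, c t)) (η t) (ζ t)
  have e4 := hprim (η t) (ζ t)
  have e5 := hA (η t) (fderiv ℝ X (t, c t) (0, ζ t))
  have e6 := hskew (η t) (fderiv ℝ X (t, c t) (0, ζ t))
  simp only [add_apply, smul_apply, smul_eq_mul,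
    one_mul] at e1 e2 ⊢
  -- The Lie derivative of the closed form `A + t β` along `X` is `-dα`, which cancels its time
  -- derivative `β`.
  linear_combination e1 - e2 + t * e3 + e5 + t * e6 - e4

end Moser

/-! ### Darboux's theorem by Moser's method -/

section Darboux

set_option maxSynthPendingDepth 3

open Filter Topology

open unitInterval

variable {E : Type u} [NormedAddCommGroup E] [NormedSpace ℝ E] [FiniteDimensional ℝ E]

/-- A time dependent vector field `X` with `ι_X (A + t β) = -α` near the origin. -/
theorem exists_moser_vectorField {A : E →L[ℝ] E →L[ℝ] ℝ} (hA : ∀ v, v ≠ 0 → ∃ w, A v w ≠ 0)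
    {β : E → E →L[ℝ] E →L[ℝ] ℝ} (hβ : ContDiff ℝ ∞ β) (hβ0 : β 0 = 0)
    {α : E → E →L[ℝ] ℝ} (hα : ContDiff ℝ ∞ α) (hα0 : α 0 = 0) (hα1 : fderiv ℝ α 0 = 0) :
    ∃ X : ℝ × E → E, ContDiff ℝ ∞ X ∧ (∀ t, X (t, 0) = 0) ∧
      (∀ t v, fderiv ℝ X (t, 0) (0, v) = 0) ∧
      ∀ᶠ y in 𝓝 (0 : E), ∀ t ∈ Set.Icc (0 : ℝ) 1, (A + t • β y) (X (t, y)) = -α y := by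
  have : CompleteSpace E := FiniteDimensional.complete ℝ E
  obtain ⟨e, rfl⟩ := exists_equiv_of_nondegenerate A hA
  have hinv : ∀ᶠ L in 𝓝 (e : E →L[ℝ] E →L[ℝ] ℝ),
      ContDiffAt ℝ ∞ ContinuousLinearMap.inverse L := by
    filter_upwards [ContinuousLinearEquiv.nhds e] with L hL
    obtain ⟨e', rfl⟩ := hL
    exact contDiffAt_map_inverse e'
  obtain ⟨Ψ, hΨ, hΨe⟩ := exists_contDiff_eventuallyEq hinv
  set Q : ℝ × E → (E →L[ℝ] ℝ) →L[ℝ] E := fun p => Ψ (e + p.1 • β p.2) with hQ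
  have hQs : ContDiff ℝ ∞ Q :=
    hΨ.comp (contDiff_const.add (contDiff_fst.smul (hβ.comp contDiff_snd)))
  set S : ℝ × E → E →L[ℝ] ℝ := fun p => -α p.2 with hS
  have hSs : ContDiff ℝ ∞ S := (hα.comp contDiff_snd).neg
  refine ⟨fun p => Q p (S p), hQs.clm_apply hSs, fun t => by simp [hS, hα0], ?_, ?_⟩
  · intro t v
    have hαd : HasFDerivAt α (0 : E →L[ℝ] E →L[ℝ] ℝ) 0 := by
      rw [← hα1]
      exact (hα.differentiable (by simp) 0).hasFDerivAt
    have h1 : HasFDerivAt S (-((0 : E →L[ℝ] E →L[ℝ] ℝ).comp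
        (ContinuousLinearMap.snd ℝ ℝ E))) (t, 0) :=
      (HasFDerivAt.comp (g := α) (t, (0 : E)) hαd hasFDerivAt_snd).neg
    have h2 := ((hQs.differentiable (by simp) (t, 0)).hasFDerivAt).clm_apply h1
    rw [h2.fderiv]
    simp [hS, hα0]
  · obtain ⟨δ, hδ, hball⟩ := Metric.eventually_nhds_iff_ball.1
      (hΨe.and (ContinuousLinearEquiv.nhds e))
    have hβ' : ∀ᶠ y in 𝓝 (0 : E), β y ∈ Metric.ball (0 : E →L[ℝ] E →L[ℝ] ℝ) δ := by
      refine hβ.continuous.continuousAt.eventually ?_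
      rw [hβ0]
      exact Metric.ball_mem_nhds _ hδ
    filter_upwards [hβ'] with y hy t ht
    -- One bound on `β y` serves all `t` in `[0, 1]`, so `Ψ` is the true inverse along the whole
    -- path.
    have hmem : (e : E →L[ℝ] E →L[ℝ] ℝ) + t • β y ∈
        Metric.ball (e : E →L[ℝ] E →L[ℝ] ℝ) δ := by
      rw [mem_ball_zero_iff] at hy
      rw [mem_ball_iff_norm, add_sub_cancel_left, norm_smul, Real.norm_of_nonneg ht.1]
      nlinarith [norm_nonneg (β y), ht.1, ht.2]
    obtain ⟨h1, e', he'⟩ := hball _ hmem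
    simp only [hQ, hS, h1]
    rw [← he', ContinuousLinearMap.inverse_equiv]
    simp

/-- **Darboux's theorem**, up to a linear change of coordinates: a symplectic form on a
neighbourhood of the origin is the pullback of its value at the origin. -/
theorem exists_openPartialHomeomorph_pullback_const (B : E → E →L[ℝ] E →L[ℝ] ℝ) {s : Set E}
    (hs : IsOpen s) (h0s : 0 ∈ s) (hB : ContDiffOn ℝ ∞ B s)
    (hskew : ∀ y ∈ s, ∀ v w, B y v w = -B y w v)
    (hclosed : ∀ y ∈ s, ∀ u v w,
      fderiv ℝ B y u v w - fderiv ℝ B y v u w + fderiv ℝ B y w u v = 0)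
    (hnd : ∀ v, v ≠ 0 → ∃ w, B 0 v w ≠ 0) :
    ∃ Φ : OpenPartialHomeomorph E E, 0 ∈ Φ.source ∧ Φ 0 = 0 ∧ Φ.target ⊆ s ∧
      ContDiffOn ℝ ∞ Φ Φ.source ∧ ContDiffOn ℝ ∞ Φ.symm Φ.target ∧
      ∀ x ∈ Φ.source, ∀ v w, B (Φ x) (fderiv ℝ Φ x v) (fderiv ℝ Φ x w) = B 0 v w := by
  have : CompleteSpace E := FiniteDimensional.complete ℝ E
  have hBat : ∀ᶠ y in 𝓝 (0 : E), ContDiffAt ℝ ∞ B y := by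
    filter_upwards [hs.mem_nhds h0s] with y hy
    exact hB.contDiffAt (hs.mem_nhds hy)
  obtain ⟨B', hB's, hB'e⟩ := exists_contDiff_eventuallyEq hBat
  have hB'0 : B' 0 = B 0 := hB'e.self_of_nhds
  set A := B 0 with hA
  set β : E → E →L[ℝ] E →L[ℝ] ℝ := fun y => B' y - A with hβ
  have hβs : ContDiff ℝ ∞ β := hB's.sub contDiff_const
  have hβ0 : β 0 = 0 := by simp [hβ, hB'0]
  have hAskew : ∀ v w, A v w = -A w v := hskew 0 h0s
  obtain ⟨r₁, hr₁, hball₁⟩ := Metric.eventually_nhds_iff_ball.1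
    (hB'e.eventuallyEq_nhds.and (hs.mem_nhds h0s))
  have hβskew : ∀ y ∈ Metric.ball (0 : E) r₁, ∀ v w, β y v w = -β y w v := by
    intro y hy v w
    have h1 := hskew y (hball₁ y hy).2 v w
    have h2 := hAskew v w
    simp only [hβ, (hball₁ y hy).1.self_of_nhds, sub_apply]
    linear_combination h1 - h2
  have hβclosed : ∀ y ∈ Metric.ball (0 : E) r₁, ∀ u v w,
      fderiv ℝ β y u v w - fderiv ℝ β y v u w + fderiv ℝ β y w u v = 0 := by
    intro y hy u v w
    have h1 : fderiv ℝ β y = fderiv ℝ B y := by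
      rw [hβ, fderiv_sub_const]
      exact (hball₁ y hy).1.fderiv_eq
    rw [h1]
    exact hclosed y (hball₁ y hy).2 u v w
  obtain ⟨α, hαs, hα0, hα1, hαp⟩ := exists_primitive_of_closed β hβs hβskew hβclosed hβ0
  obtain ⟨X, hXs, hX0, hX1, hXα⟩ := exists_moser_vectorField hnd hβs hβ0 hαs hα0 hα1
  obtain ⟨r₂, hr₂, hball₂⟩ := Metric.eventually_nhds_iff_ball.1 hXα
  obtain ⟨γ, hγ0, hγ⟩ := exists_smooth_flow X hXs hX0 hX1
  -- Trajectories starting near `0` stay, up to time one, where all the local identities hold.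
  have hγsmall : ∀ᶠ x in 𝓝 (0 : E), ‖γ x‖ < min r₁ r₂ := by
    have hc : ContinuousAt (fun x => ‖γ x‖) 0 := hγ.self_of_nhds.1.continuousAt.norm
    refine hc.eventually_lt continuousAt_const ?_
    simp [hγ0, hr₁, hr₂]
  set ψ : E → E := fun x => γ x 1 with hψ
  have hψd : ∀ x, ContDiffAt ℝ ∞ γ x → ContDiffAt ℝ ∞ ψ x ∧
      ∀ v, fderiv ℝ ψ x v = fderiv ℝ γ x v 1 := by
    intro x hx
    refine ⟨(ContinuousMap.evalCLM ℝ (1 : I) : C(I, E) →L[ℝ] E).contDiff.contDiffAt.comp x hx,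
      fun v => ?_⟩
    have := ((ContinuousMap.evalCLM ℝ (1 : I) : C(I, E) →L[ℝ] E).hasFDerivAt.comp x
      (hx.differentiableAt (by simp)).hasFDerivAt).fderiv
    exact congrArg (fun L => L v) this
  have hev : ∀ᶠ x in 𝓝 (0 : E), ContDiffAt ℝ ∞ ψ x ∧ ψ x ∈ s ∧
      ∀ v w, B (ψ x) (fderiv ℝ ψ x v) (fderiv ℝ ψ x w) = A v w := by
    filter_upwards [hγ, hγsmall] with x hx hxs
    obtain ⟨hxd, c, hc0, hcγ, hcd, hη⟩ := hx
    have hcI : ∀ t ∈ Set.Icc (0 : ℝ) 1, ‖c t‖ < min r₁ r₂ := fun t ht => by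
      have := hcγ ⟨t, ht⟩
      simp only at this
      rw [this]
      exact ((γ x).norm_coe_le_norm _).trans_lt hxs
    have hc1 : ∀ t ∈ Set.Icc (0 : ℝ) 1, c t ∈ Metric.ball (0 : E) r₁ := fun t ht =>
      mem_ball_zero_iff.2 ((hcI t ht).trans_le (min_le_left _ _))
    have hc2 : ∀ t ∈ Set.Icc (0 : ℝ) 1, c t ∈ Metric.ball (0 : E) r₂ := fun t ht =>
      mem_ball_zero_iff.2 ((hcI t ht).trans_le (min_le_right _ _))
    have hI0 : (0 : ℝ) ∈ Set.Icc (0 : ℝ) 1 := by simp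
    have hI1 : (1 : ℝ) ∈ Set.Icc (0 : ℝ) 1 := by simp
    have hψx : c 1 = ψ x := hcγ 1
    refine ⟨(hψd x hxd).1, ?_, fun v w => ?_⟩
    · rw [← hψx]
      exact (hball₁ _ (hc1 1 hI1)).2
    · obtain ⟨η, hη0, hηγ, hηd⟩ := hη v
      obtain ⟨ζ, hζ0, hζγ, hζd⟩ := hη w
      have hder : ∀ t ∈ Set.Icc (0 : ℝ) 1,
          HasDerivAt (fun s => (A + s • β (c s)) (η s) (ζ s)) 0 t := fun t ht =>
        hasDerivAt_moser (hβs.differentiable (by simp) _) (hαs.differentiable (by simp) _)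
          (hXs.differentiable (by simp) _) hAskew (hβskew _ (hc1 t ht)) (hβclosed _ (hc1 t ht))
          (hαp _ (hc1 t ht))
          (by
            filter_upwards [Metric.isOpen_ball.mem_nhds (hc2 t ht)] with y hy
            exact hball₂ y hy t ht)
          (hcd t ht) (hηd t ht) (hζd t ht)
      have hconst := constant_of_has_deriv_right_zero
        (fun t ht => (hder t ht).continuousAt.continuousWithinAt)
        (fun t ht => (hder t (Set.Ico_subset_Icc_self ht)).hasDerivWithinAt) 1 hI1
      have hη1 : η 1 = fderiv ℝ ψ x v := by
        rw [(hψd x hxd).2 v]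
        exact hηγ 1
      have hζ1 : ζ 1 = fderiv ℝ ψ x w := by
        rw [(hψd x hxd).2 w]
        exact hζγ 1
      have hB1 : A + (1 : ℝ) • β (c 1) = B (ψ x) := by
        rw [one_smul, hβ]
        beta_reduce
        rw [(hball₁ _ (hc1 1 hI1)).1.self_of_nhds, hψx]
        abel
      simp only [zero_smul, add_zero, hη0, hζ0, hη1, hζ1] at hconst
      rw [hB1] at hconst
      exact hconst
  -- A linear map pulling some form back to the nondegenerate `A` is injective, hence invertible in
  -- finite dimension.
  have hbij : ∀ x, (∀ v w, B (ψ x) (fderiv ℝ ψ x v) (fderiv ℝ ψ x w) = A v w) →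
      ∃ f' : E ≃L[ℝ] E, (f' : E →L[ℝ] E) = fderiv ℝ ψ x := by
    intro x hx
    have hinj : Function.Injective (fderiv ℝ ψ x : E →ₗ[ℝ] E) := by
      rw [← LinearMap.ker_eq_bot, LinearMap.ker_eq_bot']
      intro v hv
      by_contra hne
      obtain ⟨w, hw⟩ := hnd v hne
      refine hw ?_
      rw [← hx v w, show fderiv ℝ ψ x v = 0 from hv]
      simp
    refine ⟨(LinearEquiv.ofInjectiveEndo _ hinj).toContinuousLinearEquiv, ?_⟩
    ext v
    rfl
  have hψ0 : ψ 0 = 0 := by simp [hψ, hγ0]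
  obtain ⟨O, hOsub, hO, h0O⟩ := mem_nhds_iff.1 hev
  obtain ⟨f', hf'⟩ := hbij 0 (hOsub h0O).2.2
  have hψ00 : ContDiffAt ℝ ∞ ψ 0 := (hOsub h0O).1
  have hd0 : HasFDerivAt ψ (f' : E →L[ℝ] E) 0 := by
    rw [hf']
    exact (hψ00.differentiableAt (by simp)).hasFDerivAt
  set e := hψ00.toOpenPartialHomeomorph ψ hd0 (by simp) with he
  have h0e : (0 : E) ∈ e.source := hψ00.mem_toOpenPartialHomeomorph_source hd0 (by simp)
  have hcoe : ∀ x, e x = ψ x := fun x => rfl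
  refine ⟨e.restrOpen O hO, ⟨h0e, h0O⟩, hψ0, ?_, ?_, ?_, ?_⟩
  · intro y hy
    have h1 := (e.restrOpen O hO).map_target hy
    have h2 := (e.restrOpen O hO).right_inv hy
    rw [← h2]
    exact (hOsub h1.2).2.1
  · exact fun x hx => (hOsub hx.2).1.contDiffWithinAt
  · intro y hy
    have h1 := (e.restrOpen O hO).map_target hy
    obtain ⟨g', hg'⟩ := hbij _ (hOsub h1.2).2.2
    refine ((e.restrOpen O hO).contDiffAt_symm (f₀' := g') hy ?_ (hOsub h1.2).1).contDiffWithinAt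
    rw [hg']
    exact ((hOsub h1.2).1.differentiableAt (by simp)).hasFDerivAt
  · exact fun x hx => (hOsub hx.2).2.2

end Darboux

/-! ### Linear symplectic coordinates -/

section LinearSymplectic

set_option maxSynthPendingDepth 3

open Filter Topology

/-- Symplectic bases exist. -/
theorem exists_symplectic_family (n : ℕ) (V : Type u) [AddCommGroup V] [Module ℝ V]
    [FiniteDimensional ℝ V] (hV : Module.finrank ℝ V = 2 * n) (B : V →ₗ[ℝ] V →ₗ[ℝ] ℝ)
    (hskew : ∀ v w, B v w = -B w v) (hnd : ∀ v, v ≠ 0 → ∃ w, B v w ≠ 0) :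
    ∃ e f : Fin n → V, (∀ i j, B (e i) (e j) = 0) ∧ (∀ i j, B (f i) (f j) = 0) ∧
      ∀ i j, B (e i) (f j) = if i = j then 1 else 0 := by
  induction n generalizing V with
  | zero => exact ⟨Fin.elim0, Fin.elim0, fun i => i.elim0, fun i => i.elim0, fun i => i.elim0⟩
  | succ n ih =>
    have hself : ∀ v, B v v = 0 := fun v => by linarith [hskew v v]
    have : Nontrivial V := Module.nontrivial_of_finrank_pos (R := ℝ) (by omega)
    obtain ⟨v, hv⟩ := exists_ne (0 : V)
    obtain ⟨w₀, hw₀⟩ := hnd v hv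
    obtain ⟨w, hw⟩ : ∃ w, B v w = 1 := ⟨(B v w₀)⁻¹ • w₀, by simp [hw₀]⟩
    have hwv : B w v = -1 := by rw [hskew, hw]
    -- The kernel of `L` is the symplectic complement of the plane spanned by `v` and `w`; the
    -- induction continues there.
    set L : V →ₗ[ℝ] ℝ × ℝ := (B v).prod (B w) with hL
    have hsurj : Function.Surjective L := fun p => by
      refine ⟨p.1 • w - p.2 • v, ?_⟩
      ext <;> simp [hL, hself, hw, hwv]
    have hdim : Module.finrank ℝ (LinearMap.ker L) = 2 * n := by
      have h1 := L.finrank_range_add_finrank_ker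
      rw [LinearMap.range_eq_top.2 hsurj, finrank_top] at h1
      simp at h1
      omega
    have hmem : ∀ u : LinearMap.ker L, B v u = 0 ∧ B w u = 0 := fun u => by
      have := u.2
      rw [LinearMap.mem_ker] at this
      exact ⟨congrArg Prod.fst this, congrArg Prod.snd this⟩
    have hmem' : ∀ u : LinearMap.ker L, B u v = 0 ∧ B u w = 0 := fun u => by
      rw [hskew _ v, hskew _ w, (hmem u).1, (hmem u).2]
      simp
    obtain ⟨e, f, he, hf, hef⟩ := ih (LinearMap.ker L) hdim
      (B.compl₁₂ (LinearMap.ker L).subtype (LinearMap.ker L).subtype)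
      (fun x y => hskew x y) (fun u hu => by
        obtain ⟨x, hx⟩ := hnd u (by simpa using hu)
        -- The projection of `x` to the complement along that plane; pairing with `u` does not see
        -- the correction.
        refine ⟨⟨x - B v x • w + B w x • v, ?_⟩, ?_⟩
        · rw [LinearMap.mem_ker]
          ext <;> simp [hL, hself, hw, hwv]
        · simpa [(hmem' u).1, (hmem' u).2] using hx)
    refine ⟨Fin.cons v fun i => e i, Fin.cons w fun i => f i, ?_, ?_, ?_⟩
    · intro i j
      cases i using Fin.cases <;> cases j using Fin.cases <;>
        simp [hself, (hmem _).1, (hmem' _).1, show ∀ i j, B (e i) (e j) = 0 from he]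
    · intro i j
      cases i using Fin.cases <;> cases j using Fin.cases <;>
        simp [hself, (hmem _).2, (hmem' _).2, show ∀ i j, B (f i) (f j) = 0 from hf]
    · intro i j
      cases i using Fin.cases <;> cases j using Fin.cases <;>
        simp [hw, (hmem _).1, (hmem' _).2, Fin.succ_inj, (Fin.succ_ne_zero _).symm,
          show ∀ i j, B (e i) (f j) = if i = j then 1 else 0 from hef]

theorem stdAlternating_apply {n : ℕ} (v : Fin 2 → R2n n) :
    stdAlternating n v = ∑ j : Fin n, (v 0 ⟨2 * j, by omega⟩ * v 1 ⟨2 * j + 1, by omega⟩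
      - v 0 ⟨2 * j + 1, by omega⟩ * v 1 ⟨2 * j, by omega⟩) := rfl

/-- Each coordinate of `x` is read off, up to sign, by pairing with the basis vector of its
conjugate coordinate. -/
theorem stdAlternating_nondegenerate {n : ℕ} (x : R2n n)
    (hx : ∀ y, stdAlternating n ![x, y] = 0) : x = 0 := by
  ext i
  obtain ⟨k, hk | hk⟩ := Nat.even_or_odd' i
  · have := hx (EuclideanSpace.single ⟨2 * k + 1, by omega⟩ 1)
    rw [stdAlternating_apply, Finset.sum_eq_single ⟨k, by omega⟩] at this
    · have hi : i = ⟨2 * k, by omega⟩ := Fin.ext hk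
      rw [hi]
      simpa using this
    · intro j _ hj
      have h1 : (j : ℕ) ≠ k := fun h => hj (Fin.ext h)
      simp [h1, show ¬ (2 * (j : ℕ) = 2 * k + 1) by omega]
    · simp
  · have := hx (EuclideanSpace.single ⟨2 * k, by omega⟩ 1)
    rw [stdAlternating_apply, Finset.sum_eq_single ⟨k, by omega⟩] at this
    · have hi : i = ⟨2 * k + 1, by omega⟩ := Fin.ext hk
      rw [hi]
      simpa using this
    · intro j _ hj
      have h1 : (j : ℕ) ≠ k := fun h => hj (Fin.ext h)
      simp [h1, show ¬ (2 * (j : ℕ) + 1 = 2 * k) by omega]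
    · simp

/-- Every nondegenerate skew form on `ℝ²ⁿ` is linearly isomorphic to the standard one. -/
theorem exists_linear_symplectic_coordinates (n : ℕ) (B : R2n n →L[ℝ] R2n n →L[ℝ] ℝ)
    (hskew : ∀ v w, B v w = -B w v) (hnd : ∀ v, v ≠ 0 → ∃ w, B v w ≠ 0) :
    ∃ T : R2n n ≃L[ℝ] R2n n, ∀ x y, B (T x) (T y) = stdAlternating n ![x, y] := by
  obtain ⟨e, f, he, hf, hef⟩ := exists_symplectic_family n (R2n n) (by simp)
    (LinearMap.mk₂ ℝ (fun v w => B v w) (by simp) (by simp) (by simp) (by simp)) hskew hnd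
  simp only [LinearMap.mk₂_apply] at he hf hef
  have hfe : ∀ i j, B (f i) (e j) = if i = j then -1 else 0 := fun i j => by
    rw [hskew, hef]
    by_cases h : i = j <;> simp [h, eq_comm]
  set T : R2n n →ₗ[ℝ] R2n n :=
    { toFun := fun x => ∑ j : Fin n, (x ⟨2 * j, by omega⟩ • e j + x ⟨2 * j + 1, by omega⟩ • f j)
      map_add' := fun x y => by
        rw [← Finset.sum_add_distrib]
        refine Finset.sum_congr rfl fun j _ => ?_
        simp only [PiLp.add_apply]
        module
      map_smul' := fun c x => by
        rw [Finset.smul_sum]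
        refine Finset.sum_congr rfl fun j _ => ?_
        simp only [PiLp.smul_apply, smul_eq_mul, RingHom.id_apply]
        module } with hT
  have hTB : ∀ x y, B (T x) (T y) = stdAlternating n ![x, y] := by
    intro x y
    rw [stdAlternating_apply]
    change B (∑ j : Fin n, _) (∑ j : Fin n, _) = _
    simp only [map_sum, map_add, map_smul, sum_apply, add_apply, smul_apply, smul_eq_mul,
      he, hf, hef, hfe]
    simp only [mul_zero, zero_add, add_zero, mul_ite, mul_one, mul_neg, Finset.sum_ite_eq',
      Finset.mem_univ, if_true, Finset.sum_add_distrib]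
    simp [Finset.sum_sub_distrib, mul_comm]
    ring
  have hinj : Function.Injective T := by
    rw [← LinearMap.ker_eq_bot, LinearMap.ker_eq_bot']
    intro x hx
    refine stdAlternating_nondegenerate x fun y => ?_
    rw [← hTB, hx]
    simp
  exact ⟨(LinearEquiv.ofInjectiveEndo T hinj).toContinuousLinearEquiv, hTB⟩

end LinearSymplectic

/-! ### Darboux charts -/

section DarbouxCharts

set_option maxSynthPendingDepth 3

open Filter Topology

/-- The bilinear form underlying an alternating `2`-form. -/
noncomputable def curryTwo (E : Type*) [NormedAddCommGroup E] [NormedSpace ℝ E] :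
    E [⋀^Fin 2]→L[ℝ] ℝ →L[ℝ] E →L[ℝ] E →L[ℝ] ℝ :=
  (ContinuousLinearMap.compL ℝ E (E [⋀^Fin 1]→L[ℝ] ℝ) (E →L[ℝ] ℝ)
    (ContinuousAlternatingMap.ofSubsingletonLIE (𝕜 := ℝ) (E := E) (F := ℝ)
      (0 : Fin 1)).symm.toContinuousLinearEquiv.toContinuousLinearMap).comp
    ContinuousAlternatingMap.curryLeftLI.toContinuousLinearMap

@[simp]
theorem curryTwo_apply {E : Type*} [NormedAddCommGroup E] [NormedSpace ℝ E]
    (Ω : E [⋀^Fin 2]→L[ℝ] ℝ) (v w : E) : curryTwo E Ω v w = Ω ![v, w] := by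
  change Ω (Matrix.vecCons v _) = _
  congr 1
  ext i
  fin_cases i <;> rfl

theorem alternating_two_skew {E : Type*} [NormedAddCommGroup E] [NormedSpace ℝ E]
    (Ω : E [⋀^Fin 2]→L[ℝ] ℝ) (v w : E) : Ω ![v, w] = -Ω ![w, v] := by
  refine Eq.trans ?_ (Ω.toAlternatingMap.map_swap ![w, v] (zero_ne_one : (0 : Fin 2) ≠ 1))
  change Ω _ = Ω _
  congr 1
  ext i
  fin_cases i <;> simp

theorem alternating_two_ext {E : Type*} [NormedAddCommGroup E] [NormedSpace ℝ E]
    {Ω Ω' : E [⋀^Fin 2]→L[ℝ] ℝ} (h : ∀ v w, Ω ![v, w] = Ω' ![v, w]) : Ω = Ω' := by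
  ext v
  have : v = ![v 0, v 1] := by
    ext i
    fin_cases i <;> rfl
  rw [this]
  exact h _ _

theorem extDeriv_two_apply {E : Type*} [NormedAddCommGroup E] [NormedSpace ℝ E]
    (Ω : E → E [⋀^Fin 2]→L[ℝ] ℝ) (x u v w : E) : extDeriv Ω x ![u, v, w] =
      fderiv ℝ Ω x u ![v, w] - fderiv ℝ Ω x v ![u, w] + fderiv ℝ Ω x w ![u, v] := by
  rw [extDeriv, ContinuousAlternatingMap.alternatizeUncurryFin_apply, Fin.sum_univ_three]
  have h0 : (0 : Fin 3).removeNth ![u, v, w] = ![v, w] := by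
    ext i
    fin_cases i <;> rfl
  have h1 : (1 : Fin 3).removeNth ![u, v, w] = ![u, w] := by
    ext i
    fin_cases i <;> rfl
  have h2 : (2 : Fin 3).removeNth ![u, v, w] = ![u, v] := by
    ext i
    fin_cases i <;> rfl
  rw [h0, h1, h2]
  simp
  ring

/-- **Darboux's theorem** in an open subset of `ℝ²ⁿ`. -/
theorem exists_darboux_coordinates {n : ℕ} (Ω : R2n n → R2n n [⋀^Fin 2]→L[ℝ] ℝ) {s : Set (R2n n)}
    (hs : IsOpen s) {p : R2n n} (hp : p ∈ s) (hΩ : ContDiffOn ℝ ∞ Ω s)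
    (hclosed : ∀ y ∈ s, extDeriv Ω y = 0) (hnd : ∀ v, v ≠ 0 → ∃ w, Ω p ![v, w] ≠ 0) :
    ∃ Φ : OpenPartialHomeomorph (R2n n) (R2n n), p ∈ Φ.target ∧ Φ.target ⊆ s ∧
      ContDiffOn ℝ ∞ Φ Φ.source ∧ ContDiffOn ℝ ∞ Φ.symm Φ.target ∧
      ∀ x ∈ Φ.source, (Ω (Φ x)).compContinuousLinearMap (fderiv ℝ Φ x) = stdAlternating n := by
  set τ : R2n n ≃ₜ R2n n := Homeomorph.addLeft p with hτ
  have hτc : ContDiff ℝ ∞ τ := contDiff_const.add contDiff_id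
  have hτc' : ContDiff ℝ ∞ τ.symm := contDiff_const.add contDiff_id
  have hτ0 : τ 0 = p := by simp [hτ]
  set B : R2n n → R2n n →L[ℝ] R2n n →L[ℝ] ℝ := fun y => curryTwo (R2n n) (Ω (τ y)) with hB
  have hBd : ∀ y ∈ τ ⁻¹' s, ∀ u v w, fderiv ℝ B y u v w = fderiv ℝ Ω (τ y) u ![v, w] := by
    intro y hy u v w
    have h1 : HasFDerivAt Ω (fderiv ℝ Ω (τ y)) (τ y) :=
      ((hΩ.contDiffAt (hs.mem_nhds hy)).differentiableAt (by simp)).hasFDerivAt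
    have h2 : HasFDerivAt τ (ContinuousLinearMap.id ℝ _) y := (hasFDerivAt_id y).const_add p
    have h3 : HasFDerivAt B _ y := (curryTwo (R2n n)).hasFDerivAt.comp y (h1.comp y h2)
    rw [h3.fderiv]
    simp
  have hskew : ∀ y v w, B y v w = -B y w v := fun y v w => by
    simp only [hB, curryTwo_apply]
    exact alternating_two_skew _ _ _
  have hnd' : ∀ v, v ≠ 0 → ∃ w, B 0 v w ≠ 0 := by simpa [hB, hτ0] using hnd
  obtain ⟨Φ₀, h0, hΦ0, hΦt, hΦc, hΦc', hΦB⟩ := exists_openPartialHomeomorph_pullback_const B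
    (hs.preimage τ.continuous) (by simpa [hτ0] using hp)
    ((curryTwo (R2n n)).contDiff.comp_contDiffOn (hΩ.comp hτc.contDiffOn fun y hy => hy))
    (fun y _ => hskew y)
    (fun y hy u v w => by
      rw [hBd y hy, hBd y hy, hBd y hy, ← extDeriv_two_apply, hclosed _ hy]
      rfl) hnd'
  obtain ⟨T, hT⟩ := exists_linear_symplectic_coordinates n (B 0) (hskew 0) hnd'
  set Φ := (T.toHomeomorph.toOpenPartialHomeomorph.trans Φ₀).trans τ.toOpenPartialHomeomorph
    with hΦ
  have hsrc : ∀ x, x ∈ Φ.source ↔ T x ∈ Φ₀.source := fun x => by simp [hΦ]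
  have htgt : ∀ y, y ∈ Φ.target ↔ τ.symm y ∈ Φ₀.target := fun y => by simp [hΦ]
  have hcoe : ∀ x, Φ x = τ (Φ₀ (T x)) := fun x => rfl
  have hcoe' : ∀ y, Φ.symm y = T.symm (Φ₀.symm (τ.symm y)) := fun y => rfl
  refine ⟨Φ, ?_, ?_, ?_, ?_, ?_⟩
  · rw [htgt, ← hτ0, Homeomorph.symm_apply_apply, ← hΦ0]
    exact Φ₀.map_source h0
  · intro y hy
    have := hΦt ((htgt y).1 hy)
    simpa using this
  · exact hτc.comp_contDiffOn (hΦc.comp T.contDiff.contDiffOn fun x hx => (hsrc x).1 hx)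
  · exact T.symm.contDiff.comp_contDiffOn
      (hΦc'.comp hτc'.contDiffOn fun y hy => (htgt y).1 hy)
  · intro x hx
    rw [hsrc] at hx
    have h1 : HasFDerivAt Φ₀ (fderiv ℝ Φ₀ (T x)) (T x) :=
      ((hΦc.contDiffAt (Φ₀.open_source.mem_nhds hx)).differentiableAt (by simp)).hasFDerivAt
    have h2 : HasFDerivAt Φ _ x := (h1.comp x T.hasFDerivAt).const_add p
    refine alternating_two_ext fun v w => ?_
    rw [h2.fderiv, ← hT v w, ← hΦB _ hx, hB]
    simp only [curryTwo_apply]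
    change Ω (Φ x) _ = Ω (Φ x) _
    congr 1
    ext i
    fin_cases i <;> rfl

end DarbouxCharts

/-! ### Darboux charts on a manifold and operations on them -/

section DarbouxAtlas

set_option maxSynthPendingDepth 3

open Filter Topology

variable {n : ℕ} {M : Type*} [TopologicalSpace M] [ChartedSpace (R2n n) M]

theorem TwoForm.pullback_comp {N P : Type*} [TopologicalSpace N] [ChartedSpace (R2n n) N]
    [TopologicalSpace P] [ChartedSpace (R2n n) P] (Ω : TwoForm n P) {g : N → P} {f : M → N} {p : M}
    (hg : MDifferentiableAt (𝓡 (2 * n)) (𝓡 (2 * n)) g (f p))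
    (hf : MDifferentiableAt (𝓡 (2 * n)) (𝓡 (2 * n)) f p) :
    TwoForm.pullback (g ∘ f) Ω p = (TwoForm.pullback g Ω (f p)).compContinuousLinearMap
      (mfderiv (𝓡 (2 * n)) (𝓡 (2 * n)) f p) := by
  simp only [TwoForm.pullback]
  rw [mfderiv_comp p hg hf]
  rfl

theorem TwoForm.pullback_congr {N : Type*} [TopologicalSpace N] [ChartedSpace (R2n n) N]
    (Ω : TwoForm n N) {f g : M → N} {p : M} (h : f =ᶠ[𝓝 p] g) :
    TwoForm.pullback f Ω p = TwoForm.pullback g Ω p := by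
  simp only [TwoForm.pullback]
  rw [h.mfderiv_eq]
  have := h.self_of_nhds
  ext v
  change Ω (f p) _ = Ω (g p) _
  rw [this]

/-- A smooth chart, possibly with disconnected domain, which takes `Ω` to the standard form. -/
structure IsDarbouxChart (Ω : TwoForm n M) (e : OpenPartialHomeomorph M (R2n n)) : Prop where
  contMDiffOn : ContMDiffOn (𝓡 (2 * n)) (𝓡 (2 * n)) ∞ e e.source
  contMDiffOn_symm : ContMDiffOn (𝓡 (2 * n)) (𝓡 (2 * n)) ∞ e.symm e.target
  inChart_eq : ∀ y ∈ e.target, Ω.inChart e y = stdAlternating n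

namespace IsDarbouxChart

variable {Ω : TwoForm n M} {e e' : OpenPartialHomeomorph M (R2n n)}

/-- Changing coordinates in a smooth chart by a map which normalizes `Ω`. -/
theorem trans_symm (he : ContMDiffOn (𝓡 (2 * n)) (𝓡 (2 * n)) ∞ e e.source)
    (he' : ContMDiffOn (𝓡 (2 * n)) (𝓡 (2 * n)) ∞ e.symm e.target)
    {Φ : OpenPartialHomeomorph (R2n n) (R2n n)} (hΦ : ContDiffOn ℝ ∞ Φ Φ.source)
    (hΦ' : ContDiffOn ℝ ∞ Φ.symm Φ.target)
    (hΩ : ∀ x ∈ Φ.source, Φ x ∈ e.target →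
      (Ω.inChart e (Φ x)).compContinuousLinearMap (fderiv ℝ Φ x) = stdAlternating n) :
    IsDarbouxChart Ω (e.trans Φ.symm) where
  contMDiffOn := by
    refine (contMDiffOn_iff_contDiffOn.2 hΦ').comp (he.mono ?_) ?_
    · exact fun x hx => hx.1
    · exact fun x hx => hx.2
  contMDiffOn_symm := by
    refine he'.comp ((contMDiffOn_iff_contDiffOn.2 hΦ).mono ?_) ?_
    · exact fun x hx => hx.1
    · exact fun x hx => hx.2
  inChart_eq := by
    intro x hx
    have hx1 : x ∈ Φ.source := hx.1
    have hx2 : Φ x ∈ e.target := hx.2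
    rw [← hΩ x hx1 hx2]
    have h1 : MDifferentiableAt (𝓡 (2 * n)) (𝓡 (2 * n)) e.symm (Φ x) :=
      (he'.contMDiffAt (e.open_target.mem_nhds hx2)).mdifferentiableAt (by simp)
    have h2 : MDifferentiableAt (𝓡 (2 * n)) (𝓡 (2 * n)) Φ x :=
      ((contMDiffOn_iff_contDiffOn.2 hΦ).contMDiffAt
        (Φ.open_source.mem_nhds hx1)).mdifferentiableAt (by simp)
    have h3 := TwoForm.pullback_comp Ω h1 h2
    rw [mfderiv_eq_fderiv] at h3
    exact h3

theorem restrict (he : IsDarbouxChart Ω e) {U : Set M} (hU : IsOpen U) :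
    IsDarbouxChart Ω (e.restrOpen U hU) where
  contMDiffOn := he.contMDiffOn.mono fun _ hx => hx.1
  contMDiffOn_symm := he.contMDiffOn_symm.mono fun _ hx => hx.1
  inChart_eq := fun y hy => he.inChart_eq y hy.1

/-- The standard form has constant coefficients, so translations preserve it. This allows chart
images to be moved apart. -/
theorem trans_translate (he : IsDarbouxChart Ω e) (c : R2n n) :
    IsDarbouxChart Ω (e.trans (Homeomorph.addRight c).toOpenPartialHomeomorph) := by
  have := trans_symm (Ω := Ω) he.contMDiffOn he.contMDiffOn_symm
    (Φ := (Homeomorph.addRight c).symm.toOpenPartialHomeomorph)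
    (contDiff_id.add contDiff_const).contDiffOn (contDiff_id.add contDiff_const).contDiffOn
    (fun x _ hx => by
      rw [he.inChart_eq _ hx]
      have h : HasFDerivAt (Homeomorph.addRight c).symm.toOpenPartialHomeomorph
          (ContinuousLinearMap.id ℝ (R2n n)) x := (hasFDerivAt_id x).add_const (-c)
      rw [h.fderiv]
      rfl)
  exact this

open Classical in
-- All the conditions are local, and on each open piece the union agrees with one of the two charts.
theorem disjointUnion (he : IsDarbouxChart Ω e) (he' : IsDarbouxChart Ω e')
    (hs : Disjoint e.source e'.source) (ht : Disjoint e.target e'.target) :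
    IsDarbouxChart Ω (e.disjointUnion e' hs ht) := by
  have h1 : Set.EqOn (e.disjointUnion e' hs ht) e e.source := fun x hx =>
    Set.piecewise_eq_of_mem _ _ _ hx
  have h2 : Set.EqOn (e.disjointUnion e' hs ht) e' e'.source := fun x hx =>
    Set.piecewise_eq_of_notMem _ _ _ (Set.disjoint_right.1 hs hx)
  have h3 : Set.EqOn (e.disjointUnion e' hs ht).symm e.symm e.target := fun x hx =>
    Set.piecewise_eq_of_mem _ _ _ hx
  have h4 : Set.EqOn (e.disjointUnion e' hs ht).symm e'.symm e'.target := fun x hx =>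
    Set.piecewise_eq_of_notMem _ _ _ (Set.disjoint_right.1 ht hx)
  refine ⟨?_, ?_, ?_⟩
  · exact (he.contMDiffOn.congr h1).union_of_isOpen (he'.contMDiffOn.congr h2) e.open_source
      e'.open_source
  · exact (he.contMDiffOn_symm.congr h3).union_of_isOpen (he'.contMDiffOn_symm.congr h4)
      e.open_target e'.open_target
  · rintro y (hy | hy)
    · rw [← he.inChart_eq y hy]
      exact TwoForm.pullback_congr Ω (h3.eventuallyEq_of_mem (e.open_target.mem_nhds hy))
    · rw [← he'.inChart_eq y hy]
      exact TwoForm.pullback_congr Ω (h4.eventuallyEq_of_mem (e'.open_target.mem_nhds hy))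

end IsDarbouxChart

/-- Every point of a symplectic manifold lies in a Darboux chart with bounded target. -/
theorem IsSymplecticForm.exists_isDarbouxChart [IsManifold (𝓡 (2 * n)) ∞ M] {Ω : TwoForm n M}
    (hΩ : IsSymplecticForm Ω) (p : M) :
    ∃ e, IsDarbouxChart Ω e ∧ p ∈ e.source ∧ Bornology.IsBounded e.target := by
  set e := chartAt (R2n n) p with he
  have hat : e ∈ atlas (R2n n) M := chart_mem_atlas _ p
  have hp : p ∈ e.source := mem_chart_source _ p
  have hmax : e ∈ IsManifold.maximalAtlas (𝓡 (2 * n)) ∞ M := IsManifold.chart_mem_maximalAtlas p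
  have : IsManifold (𝓡 (2 * n)) 1 M := IsManifold.of_le (n := ∞) (by simp)
  have hmd : e.MDifferentiable (𝓡 (2 * n)) (𝓡 (2 * n)) := mdifferentiable_chart p
  obtain ⟨Φ, hpΦ, hΦt, hΦc, hΦc', hΦΩ⟩ := exists_darboux_coordinates (Ω.inChart e)
    e.open_target (e.map_source hp) (hΩ.smooth e hat) (hΩ.closed e hat) (by
      intro v hv
      have hbij := hmd.symm.mfderiv_bijective (x := e p) (e.map_source hp)
      obtain ⟨w, hw⟩ := hΩ.nondegenerate (e.symm (e p))
        (mfderiv (𝓡 (2 * n)) (𝓡 (2 * n)) e.symm (e p) v) (fun h => hv (hbij.1 (h.trans (map_zero _).symm)))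
      obtain ⟨w', hw'⟩ := hbij.2 w
      refine ⟨w', ?_⟩
      rw [← hw'] at hw
      convert hw using 1
      change Ω _ _ = Ω _ _
      congr 1
      ext i
      fin_cases i <;> rfl)
  have hD : IsDarbouxChart Ω (e.trans Φ.symm) :=
    IsDarbouxChart.trans_symm (contMDiffOn_of_mem_maximalAtlas hmax)
      (contMDiffOn_symm_of_mem_maximalAtlas hmax) hΦc hΦc' fun x hx _ => hΦΩ x hx
  set d := e.trans Φ.symm with hd
  have hpd : p ∈ d.source := ⟨hp, hpΦ⟩
  -- Shrinking to the preimage of a unit ball bounds the target, so that it can later be translated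
  -- off another one.
  refine ⟨d.restrOpen (d.source ∩ d ⁻¹' Metric.ball (d p) 1)
    (d.isOpen_inter_preimage Metric.isOpen_ball), hD.restrict _,
    ⟨hpd, hpd, by simp⟩, ?_⟩
  refine (Metric.isBounded_ball (x := d p) (r := 1)).subset fun y hy => ?_
  have h1 : d (d.symm y) ∈ Metric.ball (d p) 1 := hy.2.2
  rwa [d.right_inv hy.1] at h1

end DarbouxAtlas

/-! ### Exhausting the measure by a Darboux chart and by cubes -/

section Exhaustion

open Filter Topology

variable {n : ℕ} {M : Type*} [TopologicalSpace M] [ChartedSpace (R2n n) M]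

/-- Two bounded subsets of `ℝ²ⁿ` become disjoint after a translation of one of them. -/
theorem exists_translate_disjoint (hn : 1 ≤ n) {s t : Set (R2n n)} (hs : Bornology.IsBounded s)
    (ht : Bornology.IsBounded t) : ∃ c : R2n n, Disjoint s ((· + c) '' t) := by
  obtain ⟨R, hR⟩ := hs.subset_closedBall 0
  obtain ⟨R', hR'⟩ := ht.subset_closedBall 0
  have : NeZero (2 * n) := ⟨by omega⟩
  -- The shift exceeds the sum of the two radii. A coordinate axis to shift along exists because `1
  -- ≤ n`.
  refine ⟨EuclideanSpace.single 0 (|R| + |R'| + 1), Set.disjoint_left.2 ?_⟩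
  rintro _ hx ⟨y, hy, rfl⟩
  have h1 := mem_closedBall_zero_iff.1 (hR hx)
  have h2 := mem_closedBall_zero_iff.1 (hR' hy)
  have h3 := norm_sub_le (y + EuclideanSpace.single (0 : Fin (2 * n)) (|R| + |R'| + 1)) y
  rw [add_sub_cancel_left, PiLp.norm_single, Real.norm_of_nonneg (by positivity)] at h3
  linarith [le_abs_self R, le_abs_self R']

variable [Nonempty M] [T2Space M] [CompactSpace M] [IsManifold (𝓡 (2 * n)) ∞ M]
  [MeasurableSpace M] [BorelSpace M]

/-- The domain of a single (disconnected) Darboux chart may have almost full measure. -/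
theorem IsSymplecticForm.exists_isDarbouxChart_measure_compl_lt (hn : 1 ≤ n) {Ω : TwoForm n M}
    (hΩ : IsSymplecticForm Ω) (μ : MeasureTheory.Measure M) [MeasureTheory.IsFiniteMeasure μ]
    {ε : ENNReal} (hε : ε ≠ 0) :
    ∃ (e : OpenPartialHomeomorph M (R2n n)) (K : Set M), IsDarbouxChart Ω e ∧ IsCompact K ∧
      K ⊆ e.source ∧ μ Kᶜ < ε := by
  have : SecondCountableTopology M := ChartedSpace.secondCountable_of_sigmaCompact (R2n n) M
  -- Metrizability provides the inner regularity of `μ` by compact sets.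
  have : TopologicalSpace.MetrizableSpace M := inferInstance
  have key : ∀ ε : ENNReal, ε ≠ 0 → ∃ (e : OpenPartialHomeomorph M (R2n n)) (K : Set M),
      IsDarbouxChart Ω e ∧ Bornology.IsBounded e.target ∧ IsCompact K ∧ K ⊆ e.source ∧
      μ (Set.univ \ K) < ε := by
    refine isCompact_univ.induction_on (p := fun s => ∀ ε : ENNReal, ε ≠ 0 →
      ∃ (e : OpenPartialHomeomorph M (R2n n)) (K : Set M),
      IsDarbouxChart Ω e ∧ Bornology.IsBounded e.target ∧ IsCompact K ∧ K ⊆ e.source ∧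
      μ (s \ K) < ε) ?_ ?_ ?_ ?_
    · intro ε hε
      obtain ⟨e, he, -, heb⟩ := hΩ.exists_isDarbouxChart (Classical.arbitrary M)
      exact ⟨e, ∅, he, heb, isCompact_empty, Set.empty_subset _, by simpa [pos_iff_ne_zero]⟩
    · intro s t hst ht ε hε
      obtain ⟨e, K, he, heb, hK, hKe, hμ⟩ := ht ε hε
      exact ⟨e, K, he, heb, hK, hKe,
        (MeasureTheory.measure_mono (Set.sdiff_subset_sdiff_left hst)).trans_lt hμ⟩
    · intro s t hs ht ε hε
      -- Three losses: on `s`, on `t`, and in shrinking `K' \ K` to a compact set.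
      have hε3 : ε / 3 ≠ 0 := (ENNReal.div_pos hε (by simp)).ne'
      obtain ⟨e, K, he, heb, hK, hKe, hμ⟩ := hs _ hε3
      obtain ⟨e', K', he', heb', hK', hKe', hμ'⟩ := ht _ hε3
      obtain ⟨L, hLsub, hL, hμL⟩ := (hK'.measurableSet.diff hK.measurableSet).exists_isCompact_sdiff_lt
        (MeasureTheory.measure_ne_top μ _) hε3
      obtain ⟨U, V, hU, hV, hKU, hLV, hUV⟩ := SeparatedNhds.of_isCompact_isCompact hK hL
        (Set.disjoint_left.2 fun x hx hxL => (hLsub hxL).2 hx)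
      obtain ⟨c, hc⟩ := exists_translate_disjoint hn heb heb'
      set d := e.restrOpen U hU with hd
      set d' := (e'.trans (Homeomorph.addRight c).toOpenPartialHomeomorph).restrOpen V hV with hd'
      have hdt : d.target ⊆ e.target := fun x hx => hx.1
      have hdt' : d'.target ⊆ (· + c) '' e'.target := fun x hx =>
        ⟨x + -c, hx.1.2, by simp⟩
      have hsrc : Disjoint d.source d'.source :=
        hUV.mono (fun x hx => hx.2) (fun x hx => hx.2)
      have htgt : Disjoint d.target d'.target := hc.mono hdt hdt'
      classical
      refine ⟨d.disjointUnion d' hsrc htgt, K ∪ L,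
        (he.restrict hU).disjointUnion ((he'.trans_translate c).restrict hV) hsrc htgt,
        ?_, hK.union hL, ?_, ?_⟩
      · refine Bornology.IsBounded.union (heb.subset hdt) (Bornology.IsBounded.subset ?_ hdt')
        obtain ⟨R, hR⟩ := heb'.subset_closedBall 0
        refine (Metric.isBounded_closedBall (x := c) (r := R)).subset ?_
        rintro _ ⟨y, hy, rfl⟩
        have := mem_closedBall_zero_iff.1 (hR hy)
        simpa [dist_eq_norm] using this
      · refine Set.union_subset_union (fun x hx => ⟨hKe hx, hKU hx⟩) fun x hx => ⟨⟨?_, trivial⟩, hLV hx⟩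
        exact hKe' (hLsub hx).1
      · have hsub : (s ∪ t) \ (K ∪ L) ⊆ (s \ K) ∪ ((t \ K') ∪ ((K' \ K) \ L)) := by
          rintro x ⟨hx | hx, hxKL⟩
          · exact Or.inl ⟨hx, fun h => hxKL (Or.inl h)⟩
          · by_cases hxK' : x ∈ K'
            · exact Or.inr (Or.inr ⟨⟨hxK', fun h => hxKL (Or.inl h)⟩, fun h => hxKL (Or.inr h)⟩)
            · exact Or.inr (Or.inl ⟨hx, hxK'⟩)
        calc μ ((s ∪ t) \ (K ∪ L)) ≤ μ (s \ K) + (μ (t \ K') + μ ((K' \ K) \ L)) :=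
              (MeasureTheory.measure_mono hsub).trans ((MeasureTheory.measure_union_le _ _).trans
                (add_le_add_right (MeasureTheory.measure_union_le _ _) _))
          _ < ε / 3 + (ε / 3 + ε / 3) := ENNReal.add_lt_add hμ (ENNReal.add_lt_add hμ' hμL)
          _ = ε := by rw [← add_assoc, ENNReal.add_thirds]
    · intro x _
      obtain ⟨e, he, hx, heb⟩ := hΩ.exists_isDarbouxChart x
      obtain ⟨K, hK, hxK, hKe⟩ := exists_compact_subset e.open_source hx
      refine ⟨K, mem_nhdsWithin_of_mem_nhds (mem_interior_iff_mem_nhds.1 hxK), fun ε hε => ?_⟩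
      exact ⟨e, K, he, heb, hK, hKe, by simpa [pos_iff_ne_zero]⟩
  obtain ⟨e, K, he, -, hK, hKe, hμ⟩ := key ε hε
  exact ⟨e, K, he, hK, hKe, by rwa [Set.compl_eq_univ_sdiff]⟩

end Exhaustion

/-! ### Filling a compact set by grid cubes -/

section Cubes

open Filter Topology

open MeasureTheory

variable {n : ℕ}

/-- The centre of the cell with index `m` of the grid of mesh `a` based at `(t, …, t)`. -/
noncomputable def gridCenter (a t : ℝ) (m : Fin (2 * n) → ℤ) : R2n n :=
  WithLp.toLp 2 fun i => t + a * (m i + 1 / 2)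

theorem mem_openCube_gridCenter {a : ℝ} (ha : 0 < a) (t : ℝ) (m : Fin (2 * n) → ℤ) (x : R2n n) :
    x ∈ openCube (gridCenter a t m) a ↔
      ∀ i, (m i : ℝ) < (x i - t) / a ∧ (x i - t) / a < m i + 1 := by
  refine forall_congr' fun i => ?_
  rw [lt_div_iff₀ ha, div_lt_iff₀ ha, abs_lt]
  simp only [gridCenter]
  constructor <;> rintro ⟨h1, h2⟩ <;> constructor <;> linarith

theorem eq_floor_of_mem_openCube {a : ℝ} (ha : 0 < a) {t : ℝ} {m : Fin (2 * n) → ℤ} {x : R2n n}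
    (hx : x ∈ openCube (gridCenter a t m) a) (i : Fin (2 * n)) : m i = ⌊(x i - t) / a⌋ := by
  have := (mem_openCube_gridCenter ha t m x).1 hx i
  exact (Int.floor_eq_iff.2 ⟨this.1.le, this.2⟩).symm

/-- For a generic base point, the walls of a grid are null sets. -/
theorem exists_grid_null (ν : Measure (R2n n)) [IsFiniteMeasure ν] (a : ℝ) :
    ∃ t : ℝ, ν {x | ∃ (i : Fin (2 * n)) (m : ℤ), x i = t + a * m} = 0 := by
  -- Disjoint level sets of positive measure are countable in number, so only countably many base
  -- points are bad.
  have hcount : ∀ i : Fin (2 * n), {s : ℝ | 0 < ν {x : R2n n | x i = s}}.Countable := fun i =>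
    Measure.countable_meas_level_set_pos (g := fun x : R2n n => x i) (by fun_prop)
  have hbad : (⋃ (i : Fin (2 * n)) (m : ℤ),
      (fun s => s - a * m) '' {s : ℝ | 0 < ν {x : R2n n | x i = s}}).Countable :=
    Set.countable_iUnion fun i => Set.countable_iUnion fun m => (hcount i).image _
  obtain ⟨t, ht⟩ := (hbad.dense_compl ℝ).nonempty
  refine ⟨t, ?_⟩
  have : {x : R2n n | ∃ (i : Fin (2 * n)) (m : ℤ), x i = t + a * m} =
      ⋃ (i : Fin (2 * n)) (m : ℤ), {x | x i = t + a * m} := by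
    ext x
    simp
  rw [this]
  refine measure_iUnion_null fun i => measure_iUnion_null fun m => ?_
  by_contra h
  refine ht (Set.mem_iUnion₂.2 ⟨i, m, t + a * m, pos_iff_ne_zero.2 h, by simp⟩)

/-- A cube of side `a` has diameter at most `a √(2n)`, which is less than `a (2n + 1) = δ`. -/
theorem dist_lt_of_mem_openCube {z x y : R2n n} {δ : ℝ} (hδ : 0 < δ)
    (hx : x ∈ openCube z (δ / (2 * n + 1))) (hy : y ∈ openCube z (δ / (2 * n + 1))) :
    dist x y < δ := by
  have hn : (0 : ℝ) < 2 * n + 1 := by positivity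
  have h1 : ∀ i, dist (x i) (y i) ^ 2 ≤ (δ / (2 * n + 1)) ^ 2 := fun i => by
    refine pow_le_pow_left₀ dist_nonneg ?_ 2
    have := dist_triangle_right (x i) (y i) (z i)
    rw [Real.dist_eq (x i) (z i), Real.dist_eq (y i) (z i)] at this
    linarith [hx i, hy i]
  rw [EuclideanSpace.dist_eq, Real.sqrt_lt' hδ]
  refine (Finset.sum_le_sum fun i _ => h1 i).trans_lt ?_
  rw [Finset.sum_const, Finset.card_univ, Fintype.card_fin, nsmul_eq_mul, div_pow, mul_div_assoc',
    div_lt_iff₀ (by positivity)]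
  push_cast
  nlinarith [pow_pos hδ 2, mul_nonneg (pow_pos hδ 2).le (Nat.cast_nonneg (α := ℝ) n),
    mul_nonneg (pow_pos hδ 2).le (sq_nonneg (n : ℝ))]

/-- A compact subset of an open set is covered, up to a null set, by finitely many disjoint open
cubes of equal size inside the open set. -/
theorem exists_disjoint_cubes (ν : Measure (R2n n)) [IsFiniteMeasure ν] {K O : Set (R2n n)}
    (hK : IsCompact K) (hO : IsOpen O) (hKO : K ⊆ O) :
    ∃ (a : ℝ) (Z : Finset (R2n n)), 0 < a ∧
      (Z : Set (R2n n)).PairwiseDisjoint (fun z => openCube z a) ∧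
      (cubeUnion Z a : Set (R2n n)) ⊆ O ∧ ν (K \ cubeUnion Z a) = 0 := by
  classical
  obtain ⟨δ, hδ, hδO⟩ := hK.exists_thickening_subset_open hO hKO
  set a : ℝ := δ / (2 * n + 1) with haδ
  have ha : 0 < a := by positivity
  obtain ⟨t, ht⟩ := exists_grid_null ν a
  obtain ⟨R, hR⟩ := hK.isBounded.subset_closedBall 0
  set S : Set (Fin (2 * n) → ℤ) := {m | (openCube (gridCenter a t m) a ∩ K).Nonempty} with hS
  have hSfin : S.Finite := by
    refine (Set.finite_Icc (fun _ => ⌊(-R - t) / a⌋) fun _ => ⌊(R - t) / a⌋).subset ?_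
    rintro m ⟨x, hx, hxK⟩
    have hb : ∀ i, |x i| ≤ R := fun i =>
      (PiLp.norm_apply_le x i).trans (mem_closedBall_zero_iff.1 (hR hxK))
    refine ⟨fun i => ?_, fun i => ?_⟩
    · rw [eq_floor_of_mem_openCube ha hx i]
      exact Int.floor_le_floor (by gcongr; exact neg_le_of_abs_le (hb i))
    · rw [eq_floor_of_mem_openCube ha hx i]
      exact Int.floor_le_floor (by gcongr; exact le_of_abs_le (hb i))
  have hmem : ∀ x, x ∈ (cubeUnion (hSfin.toFinset.image (gridCenter a t)) a : Set (R2n n)) ↔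
      ∃ m ∈ S, x ∈ openCube (gridCenter a t m) a := fun x => by
    simp [cubeUnion]
  refine ⟨a, hSfin.toFinset.image (gridCenter a t), ha, ?_, ?_, ?_⟩
  · intro z hz z' hz' hzz'
    simp only [Finset.coe_image, Set.Finite.coe_toFinset] at hz hz'
    obtain ⟨m, -, rfl⟩ := hz
    obtain ⟨m', -, rfl⟩ := hz'
    refine Set.disjoint_left.2 fun x hx hx' => hzz' ?_
    congr 1
    ext i
    rw [eq_floor_of_mem_openCube ha hx i, eq_floor_of_mem_openCube ha hx' i]
  · intro x hx
    obtain ⟨m, ⟨y, hy, hyK⟩, hxm⟩ := (hmem x).1 hx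
    exact hδO (Metric.mem_thickening_iff.2 ⟨y, hyK, dist_lt_of_mem_openCube hδ hxm hy⟩)
  · refine measure_mono_null ?_ ht
    rintro x ⟨hxK, hxZ⟩
    by_contra hx
    simp only [Set.mem_ofPred_eq, not_exists] at hx
    -- A point off the walls lies in the open cell indexed by its floors; equality in the lower
    -- bound would put it on a wall.
    have hxc : x ∈ openCube (gridCenter a t fun i => ⌊(x i - t) / a⌋) a := by
      rw [mem_openCube_gridCenter ha]
      intro i
      refine ⟨(Int.floor_le _).lt_of_ne fun h => ?_, Int.lt_floor_add_one _⟩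
      refine hx i ⌊(x i - t) / a⌋ ?_
      rw [eq_div_iff ha.ne'] at h
      linarith
    exact hxZ ((hmem x).2 ⟨_, ⟨x, hxc, hxK⟩, hxc⟩)

end Cubes

/-! ### The embedding of a union of cubes -/

section Embedding

open Filter Topology

variable {n : ℕ} {M : Type*} [TopologicalSpace M] [ChartedSpace (R2n n) M]

/-- The inverse of a Darboux chart is a symplectic embedding of every open subset of its target. -/
theorem IsDarbouxChart.isSymplecticEmbedding_symm [IsManifold (𝓡 (2 * n)) ∞ M] {Ω : TwoForm n M}
    {e : OpenPartialHomeomorph M (R2n n)} (he : IsDarbouxChart Ω e)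
    (W : TopologicalSpace.Opens (R2n n)) (hW : (W : Set (R2n n)) ⊆ e.target) :
    IsSymplecticEmbedding ((stdForm n).restrict W) Ω (fun x : W => e.symm x) where
  isSmoothEmbedding := by
    -- The dimensions agree, so the complement is trivial; read in the chart `e`, the map is the
    -- identity.
    refine ⟨⟨PUnit, inferInstance, inferInstance, fun x => ?_⟩, ?_⟩
    · refine Manifold.IsImmersionAtOfComplement.mk_of_charts (.prodUnique ℝ (R2n n) _)
        (chartAt (R2n n) x) e (mem_chart_source _ x) (e.map_target (hW x.2))
        (IsManifold.chart_mem_maximalAtlas x)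
        ((IsManifold.mem_maximalAtlas_iff_contMDiffOn e).2 ⟨he.contMDiffOn, he.contMDiffOn_symm⟩)
        (fun y _ => e.map_target (hW y.2)) ?_
      intro y hy
      suffices e (e.symm ((chartAt (R2n n) x).symm y)) = y by simpa using this
      rw [e.right_inv (hW ((chartAt (R2n n) x).symm y).2)]
      have hy' : y ∈ (chartAt (R2n n) x).target := by simpa using hy
      exact (chartAt (R2n n) x).right_inv hy'
    · exact (e.symm.isOpenEmbedding_restrict.isEmbedding).comp
        (Topology.IsEmbedding.inclusion hW)
  pullback_eq := by
    funext x
    have h1 : MDifferentiableAt (𝓡 (2 * n)) (𝓡 (2 * n)) e.symm (x : R2n n) :=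
      (he.contMDiffOn_symm.contMDiffAt (e.open_target.mem_nhds (hW x.2))).mdifferentiableAt
        (by simp)
    have h2 : MDifferentiableAt (𝓡 (2 * n)) (𝓡 (2 * n)) (Subtype.val : W → R2n n) x :=
      (contMDiff_subtype_val (n := ∞)).mdifferentiableAt (by simp)
    refine (TwoForm.pullback_comp Ω h1 h2).trans ?_
    have h3 : TwoForm.pullback e.symm Ω (x : R2n n) = stdAlternating n := he.inChart_eq x (hW x.2)
    rw [h3]
    rfl

end Embedding

/-! ### The main theorem -/

theorem theorem3p1 (n : ℕ) (hn : 1 ≤ n)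
    {M : Type*} [TopologicalSpace M] [T2Space M] [CompactSpace M]
    [ChartedSpace (R2n n) M] [IsManifold (𝓡 (2 * n)) ∞ M]
    (Ω : TwoForm n M) (hΩ : IsSymplecticForm Ω)
    [MeasurableSpace M] [BorelSpace M]
    (μ : MeasureTheory.Measure M) [MeasureTheory.IsProbabilityMeasure μ]
    (ε : ℝ) (hε : 0 < ε) :
    ∃ (a : ℝ) (Z : Finset (R2n n)), 0 < a ∧
      (Z : Set (R2n n)).PairwiseDisjoint (fun z => openCube z a) ∧
      ∃ ι : cubeUnion Z a → M,
        IsSymplecticEmbedding ((stdForm n).restrict (cubeUnion Z a)) Ω ι ∧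
        μ (Set.range ι)ᶜ < ENNReal.ofReal ε := by
  have : Nonempty M := MeasureTheory.nonempty_of_isProbabilityMeasure μ
  obtain ⟨e, K, he, hK, hKe, hμ⟩ := hΩ.exists_isDarbouxChart_measure_compl_lt hn μ
    (ENNReal.ofReal_pos.2 hε).ne'
  -- Off its source `e` takes arbitrary values, so it is controlled only for `μ` restricted to `K`.
  have hmeas : AEMeasurable e (μ.restrict K) :=
    (e.continuousOn.mono hKe).aemeasurable hK.measurableSet
  obtain ⟨a, Z, ha, hZ, hZe, hnull⟩ := exists_disjoint_cubes ((μ.restrict K).map e)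
    (hK.image_of_continuousOn (e.continuousOn.mono hKe)) e.open_target
    (Set.image_subset_iff.2 fun x hx => e.map_source (hKe hx))
  refine ⟨a, Z, ha, hZ, fun x => e.symm x, he.isSymplecticEmbedding_symm _ hZe, ?_⟩
  have hnull' : μ (e ⁻¹' (e '' K \ cubeUnion Z a) ∩ K) = 0 := by
    rw [← MeasureTheory.Measure.restrict_apply' hK.measurableSet]
    exact le_antisymm ((MeasureTheory.Measure.le_map_apply hmeas _).trans hnull.le) bot_le
  have hsub : (Set.range fun x : cubeUnion Z a => e.symm x)ᶜ ⊆
      Kᶜ ∪ (e ⁻¹' (e '' K \ cubeUnion Z a) ∩ K) := by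
    intro x hx
    by_cases hxK : x ∈ K
    · refine Or.inr ⟨⟨Set.mem_image_of_mem e hxK, fun h => hx ⟨⟨e x, h⟩, ?_⟩⟩, hxK⟩
      exact e.left_inv (hKe hxK)
    · exact Or.inl hxK
  calc μ (Set.range fun x : cubeUnion Z a => e.symm x)ᶜ
      ≤ μ Kᶜ + μ (e ⁻¹' (e '' K \ cubeUnion Z a) ∩ K) :=
        (MeasureTheory.measure_mono hsub).trans (MeasureTheory.measure_union_le _ _)
    _ < ENNReal.ofReal ε := by rwa [hnull', add_zero]
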